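/- **Setting.** A function $f:\mathbb R\to\mathbb C$ is quasi-periodic if $f(x)=\Phi(x/\Omega_1,\dots,x/\Omega_N)$ with $\Phi\in C(\mathbb R^N)$ of period $1$ in each variable, $\Omega_j>0$, and $2\pi/\Omega_1,\dots,2\pi/\Omega_N$ linearly independent over $\mathbb Q$. Its mean value is $\langle f\rangle=\lim_{R\to\infty}\frac1{2R}\int_{x_0-R}^{x_0+R}f(x)\,dx$ (independent of $x_0\in\mathbb R$). Let $n\in\mathbb N_0$ and let $V\in C^\infty(\mathbb R)$ be complex-valued and quasi-periodic. Let $f_\ell\in C^\infty(\mathbb R)$, $\ell\in\mathbb N_0$, satisfy $f_0=1$ and $f_{\ell+1}'=-\frac14f_\ell'''+Vf_\ell'+\frac12V'f_\ell$ (for some choice of the integration constants), and suppose that $V$ solves the corresponding $n$th stationary KdV equation $-2f_{n+1}'=0$. Put $F_n(z,x)=\sum_{\ell=0}^nf_{n-\ell}(x)z^\ell$ and $$R_{2n+1}(z)=\tfrac12F_n''F_n-\tfrac14(F_n')^2-(V-z)F_n^2=\prod_{m=0}^{2n}(z-E_m)$$ (primes denote $x$-derivatives; the expression does not depend on $x$),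 and assume that $E_0,\dots,E_{2n}$ are distinct. Let $\mathcal C$ be the union of $n+1$ pairwise disjoint simple arcs (cuts), $n$ of which join two of the points $E_m$ and the last of which joins $E_{2n}$ to $\infty$. Let $\Pi=\mathbb C\setminus\mathcal C$, let $R_{2n+1}^{1/2}$ be a holomorphic square root of $R_{2n+1}$ on $\Pi$, and let $$g(z,x)=\frac{iF_n(z,x)}{2R_{2n+1}(z)^{1/2}},\qquad z\in\Pi,\ x\in\mathbb R .$$ For $C>0$ such that all zeros $\mu$ of all polynomials $F_n(\cdot,x)$, $x\in\mathbb R$, satisfy $|\mu|\le C$, let $\Pi_C$ be the set of all $z\in\Pi$ with $|z|>C+1$ that do not lie in the half-strip $\{\operatorname{Re}z\ge\min_m\operatorname{Re}E_m-1,\ \min_m\operatorname{Im}E_m-1\le\operatorname{Im}z\le\max_m\operatorname{Im}E_m+1\}$. **Lemma.** Such a constant $C$ exists. The mean value $\langle g(z,\cdot)\rangle$ exists for all $z\in\Pi$ and is analytic in $z\in\Pi$. For every such $C$ the following holds. 1. For $z\in\Pi_C$, $g(z,\cdot)$ has no zeros and the mean value $\langle g(z,\cdot)^{-1}\rangle$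 exists; it is analytic in $z\in\Pi_C$, and $$\big\langle g(z,\cdot)^{-1}\big\rangle=-2\int_{z_0}^z\langle g(z',\cdot)\rangle\,dz'+\big\langle g(z_0,\cdot)^{-1}\big\rangle\qquad(*)$$ for all piecewise $C^1$ paths from $z_0$ to $z$ in $\Pi_C$. 2. $\langle g(z,\cdot)^{-1}\rangle$ can be continued analytically along every (continuous) path in $\Pi$ that starts in $\Pi_C$. For this continuation, $(*)$ holds for any two successive points $z_0,z\in\Pi$ of such a path between which it is piecewise $C^1$, the integral being taken along the path. 3. $(*)$ extends continuously to either side of the cuts: if a path starts in $\Pi_C$, lies in $\Pi$ except for its end point $p$, and $p\in\mathcal C$ (the points $E_m$ included), then the continuation of $\langle g^{-1}\rangle$ along the path exists up to $p$ and has a limit $L$ at $p$. If the path is locally piecewise $C^1$ from $z_0\in\Pi$ on (the end point $p$ excepted), then the improper integral $\int_{z_0}^p\langle g(z',\cdot)\rangle\,dz'$ along the path converges and $(*)$ holds with $z=p$ and left-hand side $L$. Moreover, $L$ is a continuous boundary value from that side: for every $\varepsilon>0$ there is $\delta>0$ such that, once the path has entered the disc $|z-p|<\delta$ for good, every further continuation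 from a point of the path along any path in $\Pi\cap\{|z-p|<\delta\}$ ends with a value at distance less than $\varepsilon$ from $L$. -/

import Mathlib

open Set Filter Topology

open scoped ContDiff

noncomputable section

namespace KdV

/-! ### Mean values and quasi-periodic functions -/

/-- `f` is quasi-periodic with fundamental periods `Ω 1, …, Ω N`: it is the pull-back of a
continuous function on `ℝᴺ` of period one in every variable along a line with rationally
independent frequencies. -/
def IsQuasiPeriodic (f : ℝ → ℂ) : Prop :=
  ∃ (N : ℕ) (Ω : Fin N → ℝ) (Φ : (Fin N → ℝ) → ℂ),
    (∀ j, 0 < Ω j) ∧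
    LinearIndependent ℚ (fun j => 2 * Real.pi / Ω j) ∧
    Continuous Φ ∧
    (∀ (y : Fin N → ℝ) (j : Fin N), Φ (Function.update y j (y j + 1)) = Φ y) ∧
    ∀ x : ℝ, f x = Φ (fun j => (Ω j)⁻¹ * x)

/-- `f` has the mean value `m`: `(2R)⁻¹ ∫_{x₀-R}^{x₀+R} f → m` for every centre `x₀`. -/
def HasMeanValue (f : ℝ → ℂ) (m : ℂ) : Prop :=
  ∀ x₀ : ℝ, Tendsto (fun R : ℝ => ((2 * R : ℝ) : ℂ)⁻¹ * ∫ x in (x₀ - R)..(x₀ + R), f x)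
    atTop (𝓝 m)

/-- The mean value `⟨f⟩` (meaningful when `f` has a mean value). -/
def meanValue (f : ℝ → ℂ) : ℂ :=
  limUnder atTop (fun R : ℝ => ((2 * R : ℝ) : ℂ)⁻¹ * ∫ x in (-R)..R, f x)

/-! ### The stationary KdV hierarchy -/

/-- The recursion `f₀ = 1`,
`f_{ℓ+1}' = -(1/4) f_ℓ''' + V f_ℓ' + (1/2) V' f_ℓ`; the constants of integration are free. -/
def IsKdVSequence (V : ℝ → ℂ) (f : ℕ → ℝ → ℂ) : Prop :=
  (∀ x, f 0 x = 1) ∧ (∀ l, ContDiff ℝ ∞ (f l)) ∧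
    ∀ (l : ℕ) (x : ℝ), deriv (f (l + 1)) x =
      -(1 / 4) * iteratedDeriv 3 (f l) x + V x * deriv (f l) x + (1 / 2) * deriv V x * f l x

/-- `V` solves the `n`-th stationary KdV equation `-2 f_{n+1}' = 0`, for the choice of the
integration constants that is encoded in the sequence `f`. -/
def SolvesStationaryKdV (n : ℕ) (V : ℝ → ℂ) (f : ℕ → ℝ → ℂ) : Prop :=
  IsKdVSequence V f ∧ ∀ x, -2 * deriv (f (n + 1)) x = 0

/-- `F_n(z,x) = ∑_{ℓ=0}^n f_{n-ℓ}(x) z^ℓ`. -/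
def F (f : ℕ → ℝ → ℂ) (n : ℕ) (z : ℂ) (x : ℝ) : ℂ :=
  ∑ l ∈ Finset.range (n + 1), f (n - l) x * z ^ l

/-- `(1/2) F_n'' F_n - (1/4) (F_n')² - (V - z) F_n²`, as a function of `z` and `x`.  For a solution
of the `n`-th stationary KdV equation it does not depend on `x`. -/
def firstIntegral (V : ℝ → ℂ) (f : ℕ → ℝ → ℂ) (n : ℕ) (z : ℂ) (x : ℝ) : ℂ :=
  (1 / 2) * iteratedDeriv 2 (F f n z) x * F f n z x - (1 / 4) * (deriv (F f n z) x) ^ 2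
    - (V x - z) * (F f n z x) ^ 2

/-- The polynomial `R_{2n+1}`, that is, the `x`-independent value of the first integral (evaluated
at `x = 0`). -/
def curvePoly (V : ℝ → ℂ) (f : ℕ → ℝ → ℂ) (n : ℕ) (z : ℂ) : ℂ :=
  firstIntegral V f n z 0

/-- All zeros `μ` of the polynomials `F_n(·,x)`, `x ∈ ℝ`, satisfy `|μ| ≤ C`. -/
def ZerosBoundedBy (f : ℕ → ℝ → ℂ) (n : ℕ) (C : ℝ) : Prop :=
  ∀ (x : ℝ) (μ : ℂ), F f n μ x = 0 → ‖μ‖ ≤ C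

/-! ### The cut plane -/

/-- Nonintersecting cuts for the branch points `E 0, …, E (2n)`: `n` simple arcs, each joining two
branch points, and a simple arc joining `E (2n)` to infinity.  (Disjointness forces every branch
point to be an end point of exactly one cut.) -/
structure CutSystem (n : ℕ) (E : Fin (2 * n + 1) → ℂ) where
  first : Fin n → Fin (2 * n + 1)
  second : Fin n → Fin (2 * n + 1)
  arc : Fin n → ℝ → ℂ
  ray : ℝ → ℂ
  arc_continuous : ∀ j, ContinuousOn (arc j) (Icc 0 1)
  arc_injective : ∀ j, InjOn (arc j) (Icc 0 1)
  arc_zero : ∀ j, arc j 0 = E (first j)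
  arc_one : ∀ j, arc j 1 = E (second j)
  ray_continuous : ContinuousOn ray (Ici 0)
  ray_injective : InjOn ray (Ici 0)
  ray_zero : ray 0 = E (Fin.last (2 * n))
  ray_tendsto : Tendsto ray atTop (cocompact ℂ)
  arc_disjoint_arc : ∀ j k, j ≠ k → Disjoint (arc j '' Icc 0 1) (arc k '' Icc 0 1)
  arc_disjoint_ray : ∀ j, Disjoint (arc j '' Icc 0 1) (ray '' Ici 0)

/-- The union `𝒞` of all cuts. -/
def CutSystem.cuts {n : ℕ} {E : Fin (2 * n + 1) → ℂ} (K : CutSystem n E) : Set ℂ :=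
  (⋃ j, K.arc j '' Icc 0 1) ∪ K.ray '' Ici 0

/-- The cut plane `Π = ℂ \ 𝒞`. -/
def CutSystem.plane {n : ℕ} {E : Fin (2 * n + 1) → ℂ} (K : CutSystem n E) : Set ℂ :=
  K.cutsᶜ

/-- The set `Π_C`: the cut plane without the closed disc of radius `C + 1` about the origin and
without a closed horizontal half-strip that contains the branch points. -/
def CutSystem.outerPlane {n : ℕ} {E : Fin (2 * n + 1) → ℂ} (K : CutSystem n E) (C : ℝ) : Set ℂ :=
  K.plane \
    ({z : ℂ | ‖z‖ ≤ C + 1} ∪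
     {z : ℂ | (⨅ m, (E m).re) - 1 ≤ z.re ∧
        (⨅ m, (E m).im) - 1 ≤ z.im ∧ z.im ≤ (⨆ m, (E m).im) + 1})

/-- `S` is a holomorphic branch of `R_{2n+1}^{1/2}`, `R_{2n+1}(z) = ∏ (z - E_m)`, on `U`. -/
def IsSqrtBranch {n : ℕ} (E : Fin (2 * n + 1) → ℂ) (U : Set ℂ) (S : ℂ → ℂ) : Prop :=
  DifferentiableOn ℂ S U ∧ ∀ z ∈ U, S z ^ 2 = ∏ m, (z - E m)

/-- The diagonal Green's function `g(z,x) = i F_n(z,x) / (2 R_{2n+1}(z)^{1/2})`. -/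
def g (f : ℕ → ℝ → ℂ) (n : ℕ) (S : ℂ → ℂ) (z : ℂ) (x : ℝ) : ℂ :=
  Complex.I * F f n z x / (2 * S z)

/-- `z ↦ ⟨g(z,·)⟩`. -/
def meanG (f : ℕ → ℝ → ℂ) (n : ℕ) (S : ℂ → ℂ) (z : ℂ) : ℂ :=
  meanValue (g f n S z)

/-- `z ↦ ⟨g(z,·)⁻¹⟩`, the actual mean value (meaningful where it exists, in particular on `Π_C`). -/
def meanInvG (f : ℕ → ℝ → ℂ) (n : ℕ) (S : ℂ → ℂ) (z : ℂ) : ℂ :=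
  meanValue (fun x => (g f n S z x)⁻¹)

/-! ### Paths and analytic continuation -/

/-- `γ` is a piecewise continuously differentiable path on `[a,b]`. -/
def IsPiecewiseC1On (γ : ℝ → ℂ) (a b : ℝ) : Prop :=
  ContinuousOn γ (Icc a b) ∧
    ∃ P : Finset ℝ, ∀ c d : ℝ, a ≤ c → c < d → d ≤ b → (∀ p ∈ P, p ∉ Ioo c d) →
      ContDiffOn ℝ 1 γ (Icc c d)

/-- `∫ h(z') dz'` along the part of the path `γ` with parameters from `s` to `t`. -/
def pathIntegral (h : ℂ → ℂ) (γ : ℝ → ℂ) (s t : ℝ) : ℂ :=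
  ∫ u in s..t, h (γ u) * deriv γ u

/-- `Φ t`, `t ∈ I`, is an analytic continuation of (the germ at `γ 0` of) `φ` along the path `γ`,
parametrized by the interval `I ∋ 0`: each `Φ t` is analytic at `γ t`, and the germs of `Φ s` and
`Φ t` at `γ s` agree when `s` is close to `t`. -/
def IsContinuationAlong (φ : ℂ → ℂ) (γ : ℝ → ℂ) (I : Set ℝ) (Φ : ℝ → ℂ → ℂ) : Prop :=
  (∀ t ∈ I, AnalyticAt ℂ (Φ t) (γ t)) ∧
  (∀ t ∈ I, ∀ᶠ s in 𝓝[I] t, Φ s =ᶠ[𝓝 (γ s)] Φ t) ∧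
  Φ 0 =ᶠ[𝓝 (γ 0)] φ

end KdV

end

noncomputable section

namespace KdV

/-! ### Mean values -/

/-! The core is the identity `d⟨g⁻¹⟩/dz = -2⟨g⟩` on `Π_C`. Pointwise in `x`, the first integral and
its `z`-derivative give `∂_z g⁻¹ = -2 g + ∂_x T` (`hasDerivAt_inv_g`). Here `T` is bounded in `x`,
so `∂_x T` has mean value zero (`hasMeanValue_correction`). On `Π_C` the monic polynomials
`F_n(·,x)` have modulus at least one. Hence `g⁻¹` has a Taylor remainder in `z` that is quadratic
uniformly in `x`, and the identity passes to mean values (`hasDerivAt_meanInvG`).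

For the mean values to exist, the `f_l` have to be almost periodic, although only `V` is known to be
so. They are bounded by a blow-up argument: if not, rescaling around points of large size gives
solutions of size one whose potentials and first integrals tend to zero, while such solutions must
tend to the trivial one (`tendsto_zero_of_vanishing_potential`, `exists_solutionSize_le`). The first
integrals then express `f_{k+1}` as a polynomial in `V` and lower `f_j` with their derivatives, so
almost periodicity follows by induction, without integration
(`SolvesStationaryKdV.isAlmostPeriodic`). Boundedness also yields the constant `C`.

Since `⟨F_n⟩` is a polynomial in `z`, `-2⟨g⟩` is holomorphic on all of `Π`. Thus `⟨g⁻¹⟩` is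
continued as a primitive of a holomorphic function, disc by disc. Near an end point `p`, `-2⟨g⟩ = T
/ S` with `T` entire, and `S` is `±q` or `w q` with `w ^ 2 = z - p` and `q` holomorphic without
zeros. Either way there is a primitive on `Π` near `p` that tends to zero at `p`, whatever the shape
of the cut (`HasBoundaryPrimitive`). The continuation differs from it by a constant, which is the
boundary value (`exists_boundary_value`). -/

lemma HasMeanValue.meanValue_eq {f : ℝ → ℂ} {m : ℂ} (h : HasMeanValue f m) :
    meanValue f = m := by
  have := h 0
  simp only [zero_sub, zero_add] at this
  exact this.limUnder_eq

lemma HasMeanValue.hasMeanValue_meanValue {f : ℝ → ℂ} {m : ℂ} (h : HasMeanValue f m) :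
    HasMeanValue f (meanValue f) := by
  rwa [h.meanValue_eq]

lemma HasMeanValue.add {f g : ℝ → ℂ} {a b : ℂ} (hf : HasMeanValue f a) (hg : HasMeanValue g b)
    (cf : Continuous f) (cg : Continuous g) : HasMeanValue (fun x => f x + g x) (a + b) := by
  intro x₀
  refine ((hf x₀).add (hg x₀)).congr fun R => ?_
  rw [intervalIntegral.integral_add (cf.intervalIntegrable _ _) (cg.intervalIntegrable _ _)]
  ring

lemma HasMeanValue.const_mul {f : ℝ → ℂ} {a : ℂ} (hf : HasMeanValue f a) (c : ℂ) :
    HasMeanValue (fun x => c * f x) (c * a) := by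
  intro x₀
  refine ((hf x₀).const_mul c).congr fun R => ?_
  rw [intervalIntegral.integral_const_mul]
  ring

lemma HasMeanValue.sub {f g : ℝ → ℂ} {a b : ℂ} (hf : HasMeanValue f a) (hg : HasMeanValue g b)
    (cf : Continuous f) (cg : Continuous g) : HasMeanValue (fun x => f x - g x) (a - b) := by
  have h := hf.add (hg.const_mul (-1)) cf (continuous_const.mul cg)
  rw [show a + -1 * b = a - b by ring] at h
  refine fun x₀ => (h x₀).congr fun R => ?_
  congr 2
  ext x
  ring

lemma hasMeanValue_const (c : ℂ) : HasMeanValue (fun _ => c) c := by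
  intro x₀
  refine tendsto_const_nhds.congr' ?_
  filter_upwards [eventually_gt_atTop 0] with R hR
  rw [intervalIntegral.integral_const, Complex.real_smul, ← mul_assoc,
    show x₀ + R - (x₀ - R) = 2 * R by ring, inv_mul_cancel₀, one_mul]
  exact_mod_cast (by positivity : (2 * R : ℝ) ≠ 0)

lemma HasMeanValue.sum {ι : Type*} {s : Finset ι} {f : ι → ℝ → ℂ} {a : ι → ℂ}
    (hf : ∀ i ∈ s, HasMeanValue (f i) (a i)) (cf : ∀ i ∈ s, Continuous (f i)) :
    HasMeanValue (fun x => ∑ i ∈ s, f i x) (∑ i ∈ s, a i) := by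
  classical
  induction s using Finset.induction_on with
  | empty => simpa using hasMeanValue_const 0
  | insert i s hi ih =>
    simp only [Finset.sum_insert hi]
    refine (hf i (by simp)).add (ih (fun j hj => hf j (by simp [hj]))
      fun j hj => cf j (by simp [hj])) (cf i (by simp)) ?_
    exact continuous_finsetSum _ fun j hj => cf j (by simp [hj])

lemma norm_average_le {f : ℝ → ℂ} {B : ℝ} (hB : ∀ x, ‖f x‖ ≤ B) (x₀ : ℝ) {R : ℝ} (hR : 0 < R) :
    ‖((2 * R : ℝ) : ℂ)⁻¹ * ∫ x in (x₀ - R)..(x₀ + R), f x‖ ≤ B := by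
  have h := intervalIntegral.norm_integral_le_of_norm_le_const (a := x₀ - R) (b := x₀ + R)
    (f := f) (C := B) fun x _ => hB x
  rw [show x₀ + R - (x₀ - R) = 2 * R by ring, abs_of_pos (by positivity)] at h
  rw [norm_mul, norm_inv, Complex.norm_real, Real.norm_of_nonneg (by positivity)]
  calc (2 * R)⁻¹ * _ ≤ (2 * R)⁻¹ * (B * (2 * R)) := by gcongr
    _ = B := by field_simp

lemma HasMeanValue.norm_le {f : ℝ → ℂ} {m : ℂ} {B : ℝ} (h : HasMeanValue f m)
    (hB : ∀ x, ‖f x‖ ≤ B) : ‖m‖ ≤ B := by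
  refine le_of_tendsto (h 0).norm ?_
  filter_upwards [eventually_gt_atTop 0] with R hR using norm_average_le hB 0 hR

lemma hasMeanValue_zero_of_bounded_integral {f : ℝ → ℂ} {B : ℝ}
    (hB : ∀ a b, ‖∫ x in a..b, f x‖ ≤ B) : HasMeanValue f 0 := by
  intro x₀
  have hlim : Tendsto (fun R : ℝ => (2 * R)⁻¹ * B) atTop (𝓝 0) := by
    rw [← zero_mul B]
    exact ((tendsto_id.const_mul_atTop (by norm_num : (0 : ℝ) < 2)).inv_tendsto_atTop).mul_const B
  refine squeeze_zero_norm' ?_ hlim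
  filter_upwards [eventually_gt_atTop 0] with R hR
  rw [norm_mul, norm_inv, Complex.norm_real, Real.norm_of_nonneg (by positivity)]
  gcongr
  exact hB _ _

/-- The derivative of a bounded function has mean value zero. -/
lemma hasMeanValue_deriv_of_bounded {T T' : ℝ → ℂ} {B : ℝ} (hT : ∀ x, HasDerivAt T (T' x) x)
    (hc : Continuous T') (hB : ∀ x, ‖T x‖ ≤ B) : HasMeanValue T' 0 := by
  refine hasMeanValue_zero_of_bounded_integral (B := B + B) fun a b => ?_
  rw [intervalIntegral.integral_eq_sub_of_hasDerivAt (fun x _ => hT x) (hc.intervalIntegrable _ _)]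
  exact (norm_sub_le _ _).trans (add_le_add (hB b) (hB a))

/-- Averages are bounded by the sup norm. So the mean values of the approximants are Cauchy, and
their averages converge uniformly in `R > 0`, which permits interchanging the two limits. -/
lemma exists_hasMeanValue_of_approx {f : ℝ → ℂ} (cf : Continuous f)
    (h : ∀ ε > 0, ∃ g : ℝ → ℂ, Continuous g ∧ (∃ m, HasMeanValue g m) ∧ ∀ x, ‖f x - g x‖ ≤ ε) :
    ∃ m, HasMeanValue f m := by
  have h' : ∀ k : ℕ, ∃ g : ℝ → ℂ, Continuous g ∧ (∃ m, HasMeanValue g m) ∧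
      ∀ x, ‖f x - g x‖ ≤ 1 / (k + 1 : ℝ) := fun k => h _ (by positivity)
  choose g cg hg hfg using h'
  choose m hm using hg
  have hε := tendsto_one_div_add_atTop_nhds_zero_nat (𝕜 := ℝ)
  have hmm : ∀ k l : ℕ, dist (m k) (m l) ≤ 1 / (k + 1 : ℝ) + 1 / (l + 1 : ℝ) := by
    intro k l
    rw [dist_eq_norm]
    refine ((hm k).sub (hm l) (cg k) (cg l)).norm_le fun x => ?_
    calc ‖g k x - g l x‖ = ‖(f x - g l x) - (f x - g k x)‖ := by congr 1; ring
      _ ≤ 1 / (l + 1 : ℝ) + 1 / (k + 1 : ℝ) :=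
        (norm_sub_le _ _).trans (add_le_add (hfg l x) (hfg k x))
      _ = _ := add_comm _ _
  have hcau : CauchySeq m := by
    refine cauchySeq_of_le_tendsto_0 (fun k : ℕ => 1 / (k + 1 : ℝ) + 1 / (k + 1 : ℝ)) ?_
      (by simpa using hε.add hε)
    intro k l N hk hl
    refine (hmm k l).trans (add_le_add ?_ ?_) <;> gcongr
  obtain ⟨M, hM⟩ := cauchySeq_tendsto_of_complete hcau
  refine ⟨M, fun x₀ => ?_⟩
  refine TendstoUniformlyOnFilter.tendsto_of_eventually_tendsto
    (F := fun (k : ℕ) (R : ℝ) => ((2 * R : ℝ) : ℂ)⁻¹ * ∫ x in (x₀ - R)..(x₀ + R), g k x)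
    (p := atTop) ?_ (Eventually.of_forall fun k => hm k x₀) hM
  rw [Metric.tendstoUniformlyOnFilter_iff]
  intro ε hε0
  have h1 : ∀ᶠ k : ℕ in atTop, 1 / (k + 1 : ℝ) < ε := hε.eventually_lt_const hε0
  filter_upwards [h1.prod_mk (eventually_gt_atTop (0 : ℝ))] with ⟨k, R⟩ hkR
  obtain ⟨hk, hR⟩ := hkR
  refine lt_of_le_of_lt ?_ hk
  dsimp only at hR ⊢
  rw [dist_eq_norm, ← mul_sub, ← intervalIntegral.integral_sub (cf.intervalIntegrable _ _)
    ((cg k).intervalIntegrable _ _)]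
  exact norm_average_le (hfg k) x₀ hR

/-! ### Almost periodic functions -/

/-- The character `x ↦ exp (i κ x)`. -/
def character (κ : ℝ) : BoundedContinuousFunction ℝ ℂ :=
  BoundedContinuousFunction.ofNormedAddCommGroup
    (fun x : ℝ => Complex.exp ((κ * x : ℝ) * Complex.I)) (by fun_prop) 1
    fun x => (Complex.norm_exp_ofReal_mul_I _).le

lemma character_apply (κ x : ℝ) :
    character κ x = Complex.exp ((κ * x : ℝ) * Complex.I) := rfl

lemma character_mul (κ τ : ℝ) : character κ * character τ = character (κ + τ) := by
  ext x
  rw [BoundedContinuousFunction.mul_apply, character_apply, character_apply, character_apply,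
    ← Complex.exp_add]
  congr 1
  push_cast
  ring

lemma character_zero : character 0 = 1 := by
  ext x
  simp [character_apply]

lemma star_character (κ : ℝ) : star (character κ) = character (-κ) := by
  ext x
  simp only [BoundedContinuousFunction.star_apply, character_apply]
  change (starRingEnd ℂ) _ = _
  rw [← Complex.exp_conj]
  congr 1
  simp

/-- Trigonometric polynomials with real frequencies. -/
def trigPoly : StarSubalgebra ℂ (BoundedContinuousFunction ℝ ℂ) where
  toSubalgebra := Algebra.adjoin ℂ (range character)
  star_mem' := by
    change Algebra.adjoin ℂ (range character) ≤ star (Algebra.adjoin ℂ (range character))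
    refine Algebra.adjoin_le ?_
    rintro _ ⟨κ, rfl⟩
    exact Algebra.subset_adjoin ⟨-κ, (star_character κ).symm⟩

/-- Products of characters are characters, so the generated algebra is the linear span. Linear
properties therefore need to be checked on characters only. -/
lemma mem_span_of_mem_trigPoly {p : BoundedContinuousFunction ℝ ℂ} (hp : p ∈ trigPoly) :
    p ∈ Submodule.span ℂ (range character) := by
  have h : Subalgebra.toSubmodule (Algebra.adjoin ℂ (range character)) =
      Submodule.span ℂ (range character) := by
    apply Algebra.adjoin_eq_span_of_subset
    refine .trans (fun x => Submonoid.closure_induction (fun _ => id) ⟨0, character_zero⟩ ?_)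
      Submodule.subset_span
    rintro _ _ _ _ ⟨κ, rfl⟩ ⟨τ, rfl⟩
    exact ⟨κ + τ, (character_mul κ τ).symm⟩
  rw [← h]
  exact hp

lemma hasMeanValue_character (κ : ℝ) : ∃ m, HasMeanValue (character κ) m := by
  by_cases hκ : κ = 0
  · subst hκ
    exact ⟨1, by rw [character_zero]; exact hasMeanValue_const 1⟩
  · have hne : (κ : ℂ) * Complex.I ≠ 0 := mul_ne_zero (by exact_mod_cast hκ) Complex.I_ne_zero
    refine ⟨0, hasMeanValue_deriv_of_bounded (B := ‖(κ * Complex.I : ℂ)⁻¹‖)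
      (T := fun x => (κ * Complex.I : ℂ)⁻¹ * character κ x) (fun x => ?_)
      (character κ).continuous fun x => ?_⟩
    · have h1 : HasDerivAt (fun x : ℝ => ((κ * x : ℝ) : ℂ) * Complex.I)
          ((κ : ℂ) * Complex.I) x := by
        have := ((hasDerivAt_id x).const_mul κ).ofReal_comp.mul_const Complex.I
        simpa using this
      have h2 := (h1.cexp).const_mul ((κ * Complex.I : ℂ)⁻¹)
      refine h2.congr_deriv ?_
      rw [character_apply, mul_comm (Complex.exp _), inv_mul_cancel_left₀ hne]
    · rw [norm_mul, character_apply, Complex.norm_exp_ofReal_mul_I, mul_one]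

/-- Mean value inequality for `f x - (x - a) * f' a`, whose derivative is at most `A * |b - a|` on
the segment; the lost factor `1 / 2` is immaterial. It serves for difference quotients and for
Landau's inequality. -/
lemma norm_taylor_one_le {f f' f'' : ℝ → ℂ} {s : Set ℝ} (hs : Convex ℝ s)
    (h1 : ∀ x ∈ s, HasDerivWithinAt f (f' x) s x) (h2 : ∀ x ∈ s, HasDerivWithinAt f' (f'' x) s x)
    {A : ℝ} (hA : ∀ x ∈ s, ‖f'' x‖ ≤ A) {a b : ℝ} (ha : a ∈ s) (hb : b ∈ s) :
    ‖f b - f a - (b - a : ℝ) * f' a‖ ≤ A * |b - a| ^ 2 := by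
  have hA0 : 0 ≤ A := (norm_nonneg _).trans (hA a ha)
  have hsub : segment ℝ a b ⊆ s := hs.segment_subset ha hb
  have key := (convex_segment (𝕜 := ℝ) a b).norm_image_sub_le_of_norm_hasDerivWithin_le
    (f := fun x => f x - (x - a : ℝ) * f' a) (f' := fun x => f' x - f' a) (C := A * |b - a|)
    (x := a) (y := b) ?_ ?_ (left_mem_segment ℝ a b) (right_mem_segment ℝ a b)
  · calc _ = ‖(f b - (b - a : ℝ) * f' a) - (f a - (a - a : ℝ) * f' a)‖ := by
          congr 1; simp only [sub_self, Complex.ofReal_zero]; ring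
      _ ≤ A * |b - a| * ‖b - a‖ := key
      _ = _ := by rw [Real.norm_eq_abs]; ring
  · intro x hx
    have h3 : HasDerivWithinAt (fun x : ℝ => ((x - a : ℝ) : ℂ) * f' a) (1 * f' a)
        (segment ℝ a b) x := by
      have := (((hasDerivAt_id x).sub_const a).ofReal_comp.mul_const (f' a)).hasDerivWithinAt
        (s := segment ℝ a b)
      simpa using this
    simpa using ((h1 x (hsub hx)).mono hsub).fun_sub h3
  · intro x hx
    have h4 := hs.norm_image_sub_le_of_norm_hasDerivWithin_le h2 hA ha (hsub hx)
    refine h4.trans ?_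
    gcongr
    rw [segment_eq_uIcc] at hx
    rw [Real.norm_eq_abs]
    exact Set.abs_sub_left_of_mem_uIcc hx

/-- Almost periodic functions in the sense of Bohr: uniform limits of trigonometric polynomials. -/
def IsAlmostPeriodic (f : ℝ → ℂ) : Prop :=
  ∃ φ ∈ trigPoly.topologicalClosure, ⇑φ = f

namespace IsAlmostPeriodic

variable {f h : ℝ → ℂ}

lemma continuous (hf : IsAlmostPeriodic f) : Continuous f := by
  obtain ⟨φ, -, rfl⟩ := hf
  exact φ.continuous

lemma bounded (hf : IsAlmostPeriodic f) : ∃ B, ∀ x, ‖f x‖ ≤ B := by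
  obtain ⟨φ, -, rfl⟩ := hf
  exact ⟨‖φ‖, φ.norm_coe_le_norm⟩

lemma const (c : ℂ) : IsAlmostPeriodic fun _ => c :=
  ⟨algebraMap ℂ _ c, algebraMap_mem trigPoly.topologicalClosure c, by ext; simp⟩

lemma add (hf : IsAlmostPeriodic f) (hh : IsAlmostPeriodic h) :
    IsAlmostPeriodic fun x => f x + h x := by
  obtain ⟨φ, hφ, rfl⟩ := hf
  obtain ⟨ψ, hψ, rfl⟩ := hh
  exact ⟨φ + ψ, add_mem hφ hψ, rfl⟩

lemma mul (hf : IsAlmostPeriodic f) (hh : IsAlmostPeriodic h) :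
    IsAlmostPeriodic fun x => f x * h x := by
  obtain ⟨φ, hφ, rfl⟩ := hf
  obtain ⟨ψ, hψ, rfl⟩ := hh
  exact ⟨φ * ψ, mul_mem hφ hψ, rfl⟩

lemma const_mul (hf : IsAlmostPeriodic f) (c : ℂ) : IsAlmostPeriodic fun x => c * f x :=
  (const c).mul hf

lemma sub (hf : IsAlmostPeriodic f) (hh : IsAlmostPeriodic h) :
    IsAlmostPeriodic fun x => f x - h x := by
  obtain ⟨φ, hφ, rfl⟩ := hf
  obtain ⟨ψ, hψ, rfl⟩ := hh
  exact ⟨φ - ψ, sub_mem hφ hψ, rfl⟩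

lemma sum {ι : Type*} {s : Finset ι} {u : ι → ℝ → ℂ} (hu : ∀ i ∈ s, IsAlmostPeriodic (u i)) :
    IsAlmostPeriodic fun x => ∑ i ∈ s, u i x := by
  classical
  induction s using Finset.induction_on with
  | empty => simpa using const 0
  | insert i s hi ih =>
    simp only [Finset.sum_insert hi]
    exact (hu i (by simp)).add (ih fun j hj => hu j (by simp [hj]))

/-- The reciprocal of an almost periodic function that is bounded away from zero. -/
lemma inv (hf : IsAlmostPeriodic f) {δ : ℝ} (hδ : 0 < δ) (hb : ∀ x, δ ≤ ‖f x‖) :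
    IsAlmostPeriodic fun x => (f x)⁻¹ := by
  obtain ⟨φ, hφ, rfl⟩ := hf
  have hne : ∀ x, φ x ≠ 0 := fun x hx => by
    have := hb x
    rw [hx, norm_zero] at this
    linarith
  let ψ : BoundedContinuousFunction ℝ ℂ :=
    BoundedContinuousFunction.ofNormedAddCommGroup (fun x => (φ x)⁻¹) (φ.continuous.inv₀ hne) δ⁻¹
      fun x => by
        rw [norm_inv]
        exact inv_anti₀ hδ (hb x)
  have hmul : φ * ψ = 1 := by
    ext x
    exact mul_inv_cancel₀ (hne x)
  have : IsClosed (trigPoly.topologicalClosure : Set (BoundedContinuousFunction ℝ ℂ)) :=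
    trigPoly.isClosed_topologicalClosure
  -- Spectral permanence: an element of a closed star subalgebra of a C⋆-algebra that is invertible
  -- in the large algebra has its inverse in the subalgebra.
  have hu : IsUnit (⟨φ, hφ⟩ : trigPoly.topologicalClosure) :=
    (StarSubalgebra.coe_isUnit trigPoly.topologicalClosure).1 (IsUnit.of_mul_eq_one ψ hmul)
  obtain ⟨χ, hχ⟩ := hu.exists_right_inv
  refine ⟨χ, χ.2, ?_⟩
  ext x
  have h1 : φ x * (χ : BoundedContinuousFunction ℝ ℂ) x = 1 := by
    have := congrArg (fun a : trigPoly.topologicalClosure =>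
      (a : BoundedContinuousFunction ℝ ℂ) x) hχ
    exact this
  exact eq_inv_of_mul_eq_one_right h1

lemma exists_trigPoly (hf : IsAlmostPeriodic f) {ε : ℝ} (hε : 0 < ε) :
    ∃ p ∈ trigPoly, ∀ x, ‖f x - p x‖ ≤ ε := by
  obtain ⟨φ, hφ, rfl⟩ := hf
  obtain ⟨p, hp, hd⟩ := Metric.mem_closure_iff.1 hφ ε hε
  refine ⟨p, hp, fun x => ?_⟩
  rw [← dist_eq_norm]
  exact (BoundedContinuousFunction.dist_coe_le_dist x).trans hd.le

/-- Uniform limits of almost periodic functions are almost periodic. -/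
lemma of_approx (hf : ∀ ε > 0, ∃ u, IsAlmostPeriodic u ∧ ∀ x, ‖f x - u x‖ ≤ ε) :
    IsAlmostPeriodic f := by
  have hc : Continuous f := by
    refine continuous_of_uniform_approx_of_continuous fun s hs => ?_
    obtain ⟨ε, hε, hεs⟩ := Metric.mem_uniformity_dist.1 hs
    obtain ⟨u, hu, hfu⟩ := hf (ε / 2) (by positivity)
    refine ⟨u, hu.continuous, fun x => hεs ?_⟩
    rw [dist_eq_norm]
    linarith [hfu x]
  obtain ⟨u, hu, hfu⟩ := hf 1 one_pos
  obtain ⟨B, hB⟩ := hu.bounded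
  let φ : BoundedContinuousFunction ℝ ℂ :=
    BoundedContinuousFunction.ofNormedAddCommGroup f hc (1 + B) fun x => by
      calc ‖f x‖ = ‖(f x - u x) + u x‖ := by congr 1; ring
        _ ≤ 1 + B := (norm_add_le _ _).trans (add_le_add (hfu x) (hB x))
  refine ⟨φ, ?_, rfl⟩
  refine trigPoly.isClosed_topologicalClosure.closure_subset ?_
  rw [Metric.mem_closure_iff]
  intro ε hε
  obtain ⟨u, ⟨ψ, hψ, rfl⟩, hfu⟩ := hf (ε / 2) (by positivity)
  refine ⟨ψ, hψ, lt_of_le_of_lt ?_ (half_lt_self hε)⟩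
  refine (BoundedContinuousFunction.dist_le (by positivity)).2 fun x => ?_
  rw [dist_eq_norm]
  exact hfu x

lemma of_mem_span {p : BoundedContinuousFunction ℝ ℂ}
    (hp : p ∈ Submodule.span ℂ (range character)) : IsAlmostPeriodic p :=
  ⟨p, trigPoly.le_topologicalClosure (show p ∈ trigPoly from Algebra.span_le_adjoin ℂ _ hp), rfl⟩

/-- A translation multiplies a character by a constant; linearity and uniform approximation do the
rest. -/
lemma comp_add (hf : IsAlmostPeriodic f) (c : ℝ) : IsAlmostPeriodic fun x => f (x + c) := by
  refine of_approx fun ε hε => ?_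
  obtain ⟨p, hp, hfp⟩ := hf.exists_trigPoly hε
  refine ⟨fun x => p (x + c), ?_, fun x => hfp _⟩
  refine Submodule.span_induction (p := fun (q : BoundedContinuousFunction ℝ ℂ) _ =>
    IsAlmostPeriodic fun x => q (x + c)) ?_ ?_ ?_ ?_ (mem_span_of_mem_trigPoly hp)
  · rintro _ ⟨κ, rfl⟩
    have h1 : IsAlmostPeriodic (character κ) := of_mem_span (Submodule.subset_span ⟨κ, rfl⟩)
    have h2 := h1.const_mul (character κ c)
    refine (congrArg IsAlmostPeriodic ?_).mp h2
    ext x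
    rw [character_apply, character_apply, character_apply, ← Complex.exp_add]
    congr 1
    push_cast
    ring
  · exact const 0
  · intro q r _ _ hq hr
    exact hq.add hr
  · intro a q _ hq
    exact hq.const_mul a

/-- Almost periodic functions have mean values. -/
lemma exists_hasMeanValue (hf : IsAlmostPeriodic f) : ∃ m, HasMeanValue f m := by
  refine exists_hasMeanValue_of_approx hf.continuous fun ε hε => ?_
  obtain ⟨p, hp, hfp⟩ := hf.exists_trigPoly hε
  refine ⟨p, p.continuous, ?_, hfp⟩
  refine Submodule.span_induction (p := fun (q : BoundedContinuousFunction ℝ ℂ) _ =>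
    ∃ m, HasMeanValue q m) ?_ ?_ ?_ ?_ (mem_span_of_mem_trigPoly hp)
  · rintro _ ⟨κ, rfl⟩
    exact hasMeanValue_character κ
  · exact ⟨0, hasMeanValue_const 0⟩
  · rintro q r _ _ ⟨m, hm⟩ ⟨m', hm'⟩
    exact ⟨m + m', hm.add hm' q.continuous r.continuous⟩
  · rintro a q _ ⟨m, hm⟩
    exact ⟨a * m, hm.const_mul a⟩

lemma hasMeanValue (hf : IsAlmostPeriodic f) : HasMeanValue f (meanValue f) :=
  hf.exists_hasMeanValue.elim fun _ hm => hm.hasMeanValue_meanValue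

/-- The derivative of an almost periodic function whose second derivative is bounded. -/
lemma of_hasDerivAt {f f' f'' : ℝ → ℂ} (hf : IsAlmostPeriodic f)
    (h1 : ∀ x, HasDerivAt f (f' x) x) (h2 : ∀ x, HasDerivAt f' (f'' x) x)
    {A : ℝ} (hA : ∀ x, ‖f'' x‖ ≤ A) : IsAlmostPeriodic f' := by
  have hA0 : 0 ≤ A := (norm_nonneg _).trans (hA 0)
  refine of_approx fun ε hε => ?_
  -- The difference quotient with step `τ` is within `A * τ` of `f'`; the `+ 1` takes care of `A =
  -- 0`.
  set τ : ℝ := ε / (A + 1) with hτ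
  have hτ0 : 0 < τ := by positivity
  refine ⟨_, ((hf.comp_add τ).sub hf).const_mul ((τ : ℂ)⁻¹), fun x => ?_⟩
  have key := norm_taylor_one_le (convex_univ) (fun x _ => (h1 x).hasDerivWithinAt)
    (fun x _ => (h2 x).hasDerivWithinAt) (fun x _ => hA x) (mem_univ x) (mem_univ (x + τ))
  rw [add_sub_cancel_left, abs_of_pos hτ0] at key
  have hne : (τ : ℂ) ≠ 0 := by exact_mod_cast hτ0.ne'
  calc ‖f' x - (τ : ℂ)⁻¹ * (f (x + τ) - f x)‖
      = ‖(τ : ℂ)⁻¹ * (f (x + τ) - f x - τ * f' x)‖ := by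
        rw [← norm_neg]; congr 1; field_simp; ring
    _ ≤ τ⁻¹ * (A * τ ^ 2) := by
        rw [norm_mul, norm_inv, Complex.norm_real, Real.norm_of_nonneg hτ0.le]
        gcongr
    _ = A * τ := by field_simp
    _ ≤ (A + 1) * τ := by gcongr; linarith
    _ = ε := by rw [hτ]; field_simp

end IsAlmostPeriodic

/-! ### Quasi-periodic functions are almost periodic -/

lemma isAlmostPeriodic_comp_torus {N : ℕ} (Ψ : C(UnitAddTorus (Fin N), ℂ)) (ν : Fin N → ℝ) :
    IsAlmostPeriodic fun x : ℝ => Ψ fun j => ((ν j * x : ℝ) : UnitAddCircle) := by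
  refine IsAlmostPeriodic.of_approx fun ε hε => ?_
  -- Fourier monomials span a dense subspace of the continuous functions on the torus. Along the
  -- line, the monomial with exponent `k` becomes the character of frequency `2π ∑ k_j ν_j`.
  have hΨ : Ψ ∈ (Submodule.span ℂ (range <|
      UnitAddTorus.mFourier (d := Fin N))).topologicalClosure := by
    rw [UnitAddTorus.span_mFourier_closure_eq_top]
    trivial
  obtain ⟨p, hp, hd⟩ := Metric.mem_closure_iff.1 hΨ ε hε
  refine ⟨fun x : ℝ => p fun j => ((ν j * x : ℝ) : UnitAddCircle), ?_, fun x => ?_⟩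
  · refine Submodule.span_induction (p := fun (q : C(UnitAddTorus (Fin N), ℂ)) _ =>
      IsAlmostPeriodic fun x : ℝ => q fun j => ((ν j * x : ℝ) : UnitAddCircle)) ?_ ?_ ?_ ?_ hp
    · rintro _ ⟨k, rfl⟩
      refine (congrArg IsAlmostPeriodic ?_).mp (IsAlmostPeriodic.of_mem_span
        (Submodule.subset_span ⟨∑ j, 2 * Real.pi * k j * ν j, rfl⟩))
      ext x
      simp only [UnitAddTorus.mFourier, ContinuousMap.coe_mk, fourier_coe_apply, character_apply]
      rw [← Complex.exp_sum, Finset.sum_mul]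
      push_cast
      rw [Finset.sum_mul]
      congr 1
      refine Finset.sum_congr rfl fun j _ => ?_
      ring
    · exact IsAlmostPeriodic.const 0
    · intro q r _ _ hq hr
      exact hq.add hr
    · intro a q _ hq
      exact hq.const_mul a
  · rw [← dist_eq_norm]
    exact (ContinuousMap.dist_apply_le_dist _).trans hd.le

/-- Iteration gives integer shifts of one coordinate; the coordinates are then shifted one at a
time, `s` being the set of those already shifted. -/
lemma periodic_of_update {N : ℕ} {Φ : (Fin N → ℝ) → ℂ}
    (hΦ : ∀ (y : Fin N → ℝ) (j : Fin N), Φ (Function.update y j (y j + 1)) = Φ y)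
    (y : Fin N → ℝ) (k : Fin N → ℤ) : Φ (fun j => y j + k j) = Φ y := by
  have h1 : ∀ (y : Fin N → ℝ) (j : Fin N) (m : ℤ), Φ (Function.update y j (y j + m)) = Φ y := by
    intro y j m
    have hp : Function.Periodic (fun t => Φ (Function.update y j t)) 1 := fun t => by
      have := hΦ (Function.update y j t) j
      simpa using this
    have := hp.int_mul m (y j)
    simpa using this
  have h2 : ∀ s : Finset (Fin N), Φ (fun j => if j ∈ s then y j + k j else y j) = Φ y := by
    intro s
    induction s using Finset.induction_on with
    | empty => simp
    | insert i s hi ih =>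
      rw [← ih, ← h1 (fun j => if j ∈ s then y j + k j else y j) i (k i)]
      congr 1
      ext j
      by_cases hj : j = i
      · subst hj
        simp [hi]
      · simp [hj]
  simpa using h2 Finset.univ

/-- `Φ` is constant on the fibres of the quotient map from `ℝᴺ` to the torus, hence descends to a
continuous function there. -/
lemma IsQuasiPeriodic.isAlmostPeriodic {f : ℝ → ℂ} (hf : IsQuasiPeriodic f) :
    IsAlmostPeriodic f := by
  obtain ⟨N, Ω, Φ, -, -, hΦ, hper, hfΦ⟩ := hf
  let π : (Fin N → ℝ) → UnitAddTorus (Fin N) :=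
    Pi.map fun _ => ((↑) : ℝ → UnitAddCircle)
  have hπ : IsOpenQuotientMap π :=
    IsOpenQuotientMap.piMap fun _ => QuotientAddGroup.isOpenQuotientMap_mk
  have hfib : ∀ y y', π y = π y' → Φ y = Φ y' := by
    intro y y' h
    have hk : ∀ j, ∃ k : ℤ, y j = y' j + k := by
      intro j
      have hj : ((y j : ℝ) : UnitAddCircle) = ((y' j : ℝ) : UnitAddCircle) := congrFun h j
      rw [← sub_eq_zero, ← AddCircle.coe_sub, AddCircle.coe_eq_zero_iff] at hj
      obtain ⟨k, hk⟩ := hj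
      exact ⟨k, by simp only [zsmul_eq_mul, mul_one] at hk; linarith⟩
    choose k hk using hk
    rw [show y = fun j => y' j + k j from funext hk]
    exact periodic_of_update hper y' k
  let Ψ : C(UnitAddTorus (Fin N), ℂ) :=
    IsQuotientMap.lift (f := ⟨π, hπ.continuous⟩) hπ.isQuotientMap ⟨Φ, hΦ⟩ hfib
  have hΨ : ∀ y, Ψ (π y) = Φ y := fun y =>
    DFunLike.congr_fun (IsQuotientMap.lift_comp (f := ⟨π, hπ.continuous⟩) hπ.isQuotientMap ⟨Φ, hΦ⟩ hfib) y
  refine (congrArg IsAlmostPeriodic ?_).mp (isAlmostPeriodic_comp_torus Ψ fun j => (Ω j)⁻¹)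
  ext x
  rw [hfΦ x, ← hΨ]
  rfl

/-! ### First integrals of the stationary KdV hierarchy -/

lemma hasDerivAt_iteratedDeriv {u : ℝ → ℂ} (hu : ContDiff ℝ ∞ u) (k : ℕ) (x : ℝ) :
    HasDerivAt (iteratedDeriv k u) (iteratedDeriv (k + 1) u x) x := by
  rw [iteratedDeriv_succ]
  exact (hu.differentiable_iteratedDeriv k
    (WithTop.coe_lt_coe.2 (ENat.natCast_lt_top k)) x).hasDerivAt

lemma hasDerivAt_of_contDiff {u : ℝ → ℂ} (hu : ContDiff ℝ ∞ u) (x : ℝ) :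
    HasDerivAt u (iteratedDeriv 1 u x) x := by
  have h := hasDerivAt_iteratedDeriv hu 0 x
  rwa [iteratedDeriv_zero] at h

namespace IsKdVSequence

variable {V : ℝ → ℂ} {f : ℕ → ℝ → ℂ}

lemma apply_zero (h : IsKdVSequence V f) (x : ℝ) : f 0 x = 1 := h.1 x

lemma contDiff (h : IsKdVSequence V f) (l : ℕ) : ContDiff ℝ ∞ (f l) := h.2.1 l

lemma iteratedDeriv_one_zero (h : IsKdVSequence V f) (x : ℝ) : iteratedDeriv 1 (f 0) x = 0 := by
  rw [iteratedDeriv_one, show f 0 = fun _ => (1 : ℂ) from funext h.1, deriv_const]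

lemma iteratedDeriv_two_zero (h : IsKdVSequence V f) (x : ℝ) : iteratedDeriv 2 (f 0) x = 0 := by
  rw [show f 0 = fun _ => (1 : ℂ) from funext h.1]
  simp [iteratedDeriv_const]

lemma recursion (h : IsKdVSequence V f) (l : ℕ) (x : ℝ) :
    iteratedDeriv 1 (f (l + 1)) x = -(1 / 4) * iteratedDeriv 3 (f l) x +
      V x * iteratedDeriv 1 (f l) x + (1 / 2) * iteratedDeriv 1 V x * f l x := by
  have := h.2.2 l x
  rwa [← iteratedDeriv_one, ← iteratedDeriv_one, ← iteratedDeriv_one] at this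

end IsKdVSequence

/-- The coefficients of the first integral of the stationary KdV hierarchy. -/
def integralCoeff (V : ℝ → ℂ) (f : ℕ → ℝ → ℂ) (k : ℕ) (x : ℝ) : ℂ :=
  (∑ p ∈ Finset.HasAntidiagonal.antidiagonal k, ((1 / 2) * (iteratedDeriv 2 (f p.1) x * f p.2 x)
      - (1 / 4) * (iteratedDeriv 1 (f p.1) x * iteratedDeriv 1 (f p.2) x)
      - V x * (f p.1 x * f p.2 x))) +
    ∑ p ∈ Finset.HasAntidiagonal.antidiagonal (k + 1), f p.1 x * f p.2 x

lemma sum_antidiagonal_mul_swap (k : ℕ) (a b : ℕ → ℂ) :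
    ∑ p ∈ Finset.HasAntidiagonal.antidiagonal k, a p.1 * b p.2 = ∑ p ∈ Finset.HasAntidiagonal.antidiagonal k, b p.1 * a p.2 := by
  rw [← Finset.Nat.sum_antidiagonal_swap]
  exact Finset.sum_congr rfl fun p _ => mul_comm _ _

/-- The second sum has derivative `2 ∑ f_p' f_q` over `p + q = k + 1`. The term with `p = 0`
vanishes because `f_0' = 0`; in the others the recursion lowers `p` by one. The result cancels the
derivative of the first sum after symmetrization in `p` and `q`. -/
lemma IsKdVSequence.hasDerivAt_integralCoeff {V : ℝ → ℂ} {f : ℕ → ℝ → ℂ} (hV : ContDiff ℝ ∞ V)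
    (h : IsKdVSequence V f) (k : ℕ) (x : ℝ) : HasDerivAt (integralCoeff V f k) 0 x := by
  have d0 : ∀ l, HasDerivAt (f l) (iteratedDeriv 1 (f l) x) x := fun l =>
    hasDerivAt_of_contDiff (h.contDiff l) x
  have dk : ∀ j l, HasDerivAt (iteratedDeriv j (f l)) (iteratedDeriv (j + 1) (f l) x) x :=
    fun j l => hasDerivAt_iteratedDeriv (h.contDiff l) j x
  have dV := hasDerivAt_of_contDiff hV x
  have H := (HasDerivAt.fun_sum (u := Finset.HasAntidiagonal.antidiagonal k) fun p _ =>
    ((((dk 2 p.1).mul (d0 p.2)).const_mul (1 / 2 : ℂ)).sub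
      (((dk 1 p.1).mul (dk 1 p.2)).const_mul (1 / 4 : ℂ))).sub
      (dV.mul ((d0 p.1).mul (d0 p.2)))).add
    (HasDerivAt.fun_sum (u := Finset.HasAntidiagonal.antidiagonal (k + 1)) fun p _ => (d0 p.1).mul (d0 p.2))
  refine H.congr_deriv ?_
  norm_num only
  have e1 := sum_antidiagonal_mul_swap k (fun l => iteratedDeriv 1 (f l) x)
    fun l => iteratedDeriv 2 (f l) x
  have e2 := sum_antidiagonal_mul_swap k (fun l => f l x) fun l => iteratedDeriv 1 (f l) x
  have e3 := sum_antidiagonal_mul_swap (k + 1) (fun l => f l x) fun l => iteratedDeriv 1 (f l) x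
  have e4 : ∑ p ∈ Finset.HasAntidiagonal.antidiagonal (k + 1), iteratedDeriv 1 (f p.1) x * f p.2 x =
      ∑ p ∈ Finset.HasAntidiagonal.antidiagonal k, (-(1 / 4) * (iteratedDeriv 3 (f p.1) x * f p.2 x) +
        V x * (iteratedDeriv 1 (f p.1) x * f p.2 x) +
        (1 / 2) * iteratedDeriv 1 V x * (f p.1 x * f p.2 x)) := by
    rw [Finset.Nat.sum_antidiagonal_succ]
    simp only [h.iteratedDeriv_one_zero, zero_mul, zero_add]
    refine Finset.sum_congr rfl fun p _ => ?_
    rw [h.recursion]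
    ring
  simp only [Pi.mul_apply, mul_add, Finset.sum_add_distrib, Finset.sum_sub_distrib,
    ← Finset.mul_sum] at e1 e2 e3 e4 ⊢
  linear_combination (2 : ℂ) * e4 + e3 - (1 / 4 : ℂ) * e1 - V x * e2

lemma eq_of_hasDerivAt_zero {u : ℝ → ℂ} (h : ∀ x, HasDerivAt u 0 x) (x y : ℝ) : u x = u y :=
  is_const_of_deriv_eq_zero (fun x => (h x).differentiableAt) (fun x => (h x).deriv) x y

lemma IsKdVSequence.integralCoeff_eq {V : ℝ → ℂ} {f : ℕ → ℝ → ℂ} (hV : ContDiff ℝ ∞ V)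
    (h : IsKdVSequence V f) (k : ℕ) (x y : ℝ) : integralCoeff V f k x = integralCoeff V f k y :=
  eq_of_hasDerivAt_zero (h.hasDerivAt_integralCoeff hV k) x y

/-- The `j`-th `x`-derivative of `F_n(z,x)`. -/
def Fder (f : ℕ → ℝ → ℂ) (n j : ℕ) (z : ℂ) (x : ℝ) : ℂ :=
  ∑ l ∈ Finset.range (n + 1), iteratedDeriv j (f (n - l)) x * z ^ l

/-- The `z`-derivative of the `j`-th `x`-derivative of `F_n(z,x)`. -/
def FderZ (f : ℕ → ℝ → ℂ) (n j : ℕ) (z : ℂ) (x : ℝ) : ℂ :=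
  ∑ l ∈ Finset.range (n + 1), iteratedDeriv j (f (n - l)) x * (l * z ^ (l - 1))

lemma Fder_zero (f : ℕ → ℝ → ℂ) (n : ℕ) (z : ℂ) : Fder f n 0 z = F f n z := by
  ext x
  simp [Fder, F]

lemma hasDerivAt_Fder {f : ℕ → ℝ → ℂ} (hf : ∀ l, ContDiff ℝ ∞ (f l)) (n j : ℕ) (z : ℂ) (x : ℝ) :
    HasDerivAt (Fder f n j z) (Fder f n (j + 1) z x) x :=
  HasDerivAt.fun_sum fun l _ => (hasDerivAt_iteratedDeriv (hf (n - l)) j x).mul_const _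

lemma hasDerivAt_FderZ {f : ℕ → ℝ → ℂ} (hf : ∀ l, ContDiff ℝ ∞ (f l)) (n j : ℕ) (z : ℂ) (x : ℝ) :
    HasDerivAt (FderZ f n j z) (FderZ f n (j + 1) z x) x :=
  HasDerivAt.fun_sum fun l _ => (hasDerivAt_iteratedDeriv (hf (n - l)) j x).mul_const _

lemma hasDerivAt_Fder_z (f : ℕ → ℝ → ℂ) (n j : ℕ) (z : ℂ) (x : ℝ) :
    HasDerivAt (fun z => Fder f n j z x) (FderZ f n j z x) z :=
  HasDerivAt.fun_sum fun l _ => (hasDerivAt_pow l z).const_mul _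

lemma firstIntegral_eq {V : ℝ → ℂ} {f : ℕ → ℝ → ℂ} (hf : ∀ l, ContDiff ℝ ∞ (f l)) (n : ℕ)
    (z : ℂ) (x : ℝ) : firstIntegral V f n z x = (1 / 2) * Fder f n 2 z x * Fder f n 0 z x -
      (1 / 4) * Fder f n 1 z x ^ 2 - (V x - z) * Fder f n 0 z x ^ 2 := by
  have h1 : deriv (Fder f n 0 z) = Fder f n 1 z :=
    funext fun x => (hasDerivAt_Fder hf n 0 z x).deriv
  have h2 : deriv (Fder f n 1 z) = Fder f n 2 z :=
    funext fun x => (hasDerivAt_Fder hf n 1 z x).deriv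
  rw [firstIntegral, ← Fder_zero, iteratedDeriv_succ, iteratedDeriv_one, h1, h2]

namespace SolvesStationaryKdV

variable {n : ℕ} {V : ℝ → ℂ} {f : ℕ → ℝ → ℂ}

lemma iteratedDeriv_one_succ (h : SolvesStationaryKdV n V f) (x : ℝ) :
    iteratedDeriv 1 (f (n + 1)) x = 0 := by
  have := h.2 x
  rw [iteratedDeriv_one]
  simpa using this

/-- Multiplying the recursion by powers of `z` and summing shifts the index by one. The two boundary
terms contain `f_0'` and `f_{n+1}'`, and the latter is zero by stationarity. -/
lemma Fder_three (h : SolvesStationaryKdV n V f) (z : ℂ) (x : ℝ) :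
    Fder f n 3 z x = 4 * (V x - z) * Fder f n 1 z x + 2 * iteratedDeriv 1 V x * Fder f n 0 z x := by
  have h1 : ∑ l ∈ Finset.range (n + 1), iteratedDeriv 1 (f (n - l + 1)) x * z ^ l =
      z * Fder f n 1 z x := by
    rw [Finset.sum_range_succ', Fder, Finset.sum_range_succ _ n, Nat.sub_self,
      h.1.iteratedDeriv_one_zero, Nat.sub_zero, h.iteratedDeriv_one_succ, zero_mul, zero_mul,
      add_zero, add_zero, Finset.mul_sum]
    refine Finset.sum_congr rfl fun l hl => ?_
    rw [show n - (l + 1) + 1 = n - l by have := Finset.mem_range.1 hl; omega, pow_succ]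
    ring
  simp only [h.1.recursion, add_mul, Finset.sum_add_distrib, mul_assoc, ← Finset.mul_sum] at h1
  simp only [Fder, iteratedDeriv_zero] at h1 ⊢
  linear_combination (-4 : ℂ) * h1

/-- The `x`-derivative is `F * ((1/2) F''' - 2 (V - z) F' - V' F)`, which vanishes by the third
order equation for `F`. -/
lemma firstIntegral_eq_curvePoly (h : SolvesStationaryKdV n V f) (hV : ContDiff ℝ ∞ V) (z : ℂ)
    (x : ℝ) : firstIntegral V f n z x = curvePoly V f n z := by
  refine eq_of_hasDerivAt_zero (u := firstIntegral V f n z) (fun x => ?_) x 0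
  have hf := h.1.contDiff
  rw [show firstIntegral V f n z = _ from funext (firstIntegral_eq hf n z)]
  have d := hasDerivAt_Fder hf n
  refine (((((d 2 z x).const_mul (1 / 2 : ℂ)).mul (d 0 z x)).sub
    (((d 1 z x).pow 2).const_mul (1 / 4 : ℂ))).sub
    (((hasDerivAt_of_contDiff hV x).sub_const z).mul ((d 0 z x).pow 2))).congr_deriv ?_
  rw [show 2 + 1 = 3 from rfl, h.Fder_three]
  norm_num
  ring

end SolvesStationaryKdV

/-! ### Boundedness of the solutions -/

/-- When `a 0 = 1`, this isolates `a (k + 1)`: the `k`-th first integral determines `f_{k+1}` from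
the lower functions. -/
lemma sum_antidiagonal_mul_self (a : ℕ → ℂ) (k : ℕ) :
    ∑ p ∈ Finset.HasAntidiagonal.antidiagonal (k + 1), a p.1 * a p.2 = 2 * a 0 * a (k + 1) +
      ∑ p ∈ (Finset.HasAntidiagonal.antidiagonal (k + 1)).filter (fun p => p.1 ≠ 0 ∧ p.2 ≠ 0),
        a p.1 * a p.2 := by
  rw [← Finset.sum_filter_not_add_sum_filter _ (fun p : ℕ × ℕ => p.1 ≠ 0 ∧ p.2 ≠ 0)]
  congr 1
  have : (Finset.HasAntidiagonal.antidiagonal (k + 1)).filter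
      (fun p : ℕ × ℕ => ¬(p.1 ≠ 0 ∧ p.2 ≠ 0)) = {(0, k + 1), (k + 1, 0)} := by
    ext ⟨p, q⟩
    simp only [Finset.mem_filter, Finset.HasAntidiagonal.mem_antidiagonal, Finset.mem_insert,
      Finset.mem_singleton, Prod.mk.injEq]
    omega
  rw [this, Finset.sum_pair (by simp)]
  ring

/-- A continuous function that is large somewhere is at most doubled on the natural length scale
around a suitable point. -/
lemma exists_scale {M : ℝ → ℝ} (hc : Continuous M) (h0 : ∀ x, 0 ≤ M x) {a : ℝ} (ha : 2 ≤ M a) :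
    ∃ x, M a ≤ M x ∧ ∀ x', |x' - x| ≤ (M x)⁻¹ → M x' ≤ 2 * M x := by
  -- The weight `1 - |x - a|` vanishes at the ends of the interval. With `d` its value at the
  -- maximizer `x`, `2 ≤ M a ≤ d * M x` puts the radius `(M x)⁻¹` below `d / 2`, so the weight stays
  -- at least `d / 2` there and `M` at most doubles.
  obtain ⟨x, hx, hmax⟩ := (isCompact_Icc (a := a - 1) (b := a + 1)).exists_isMaxOn
    ⟨a, by constructor <;> linarith⟩
    (f := fun x => (1 - |x - a|) * M x) (by fun_prop)
  have hxa : |x - a| ≤ 1 := abs_le.2 ⟨by linarith [hx.1], by linarith [hx.2]⟩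
  have h1 : M a ≤ (1 - |x - a|) * M x := by
    have := hmax (show a ∈ Icc (a - 1) (a + 1) by constructor <;> linarith)
    simpa using this
  have h2 : M a ≤ M x := by nlinarith [abs_nonneg (x - a), h0 x]
  refine ⟨x, h2, fun x' hx' => ?_⟩
  have hMx : 0 < M x := by linarith
  set d := 1 - |x - a| with hd
  have hdM : (M x)⁻¹ ≤ d / 2 := by
    rw [inv_le_iff_one_le_mul₀ hMx]
    nlinarith
  have h3 : |x' - a| ≤ 1 - d / 2 := by
    have := abs_sub_le x' x a
    linarith
  have hd0 : 0 < d := by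
    have := inv_pos.2 hMx
    linarith
  have hx'I : x' ∈ Icc (a - 1) (a + 1) := by
    have := abs_le.1 h3
    constructor <;> linarith [this.1, this.2]
  have h4 : (1 - |x' - a|) * M x' ≤ d * M x := hmax hx'I
  have h5 : d / 2 * M x' ≤ d * M x := le_trans (mul_le_mul_of_nonneg_right (by linarith) (h0 x')) h4
  nlinarith

/-- Landau's inequality on `[-1, 1]`. -/
lemma norm_deriv_le_of_oscillation {h h' h'' : ℝ → ℂ} (h1 : ∀ x, HasDerivAt h (h' x) x)
    (h2 : ∀ x, HasDerivAt h' (h'' x) x) {A ε τ : ℝ} (hA : ∀ x ∈ Icc (-1 : ℝ) 1, ‖h'' x‖ ≤ A)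
    (hε : ∀ x ∈ Icc (-1 : ℝ) 1, ‖h x - h 0‖ ≤ ε) (hτ : 0 < τ) (hτ1 : τ ≤ 1) {x : ℝ}
    (hx : x ∈ Icc (-1 : ℝ) 1) : ‖h' x‖ ≤ 2 * ε / τ + A * τ := by
  have key : ∀ b ∈ Icc (-1 : ℝ) 1, |b - x| = τ → ‖h' x‖ ≤ 2 * ε / τ + A * τ := by
    intro b hb hbx
    have h3 := norm_taylor_one_le (convex_Icc (-1 : ℝ) 1)
      (fun x _ => (h1 x).hasDerivWithinAt) (fun x _ => (h2 x).hasDerivWithinAt) hA hx hb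
    rw [hbx] at h3
    have h4 : ‖((b - x : ℝ) : ℂ) * h' x‖ ≤ 2 * ε + A * τ ^ 2 := by
      calc ‖((b - x : ℝ) : ℂ) * h' x‖
          = ‖(h b - h 0) - (h x - h 0) - (h b - h x - (b - x : ℝ) * h' x)‖ := by
            congr 1; ring
        _ ≤ ‖h b - h 0‖ + ‖h x - h 0‖ + ‖h b - h x - (b - x : ℝ) * h' x‖ :=
            (norm_sub_le _ _).trans (add_le_add_left (norm_sub_le _ _) _)
        _ ≤ ε + ε + A * τ ^ 2 := by gcongr; exacts [hε b hb, hε x hx]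
        _ = _ := by ring
    rw [norm_mul, Complex.norm_real, Real.norm_eq_abs, hbx] at h4
    rw [show 2 * ε / τ + A * τ = (2 * ε + A * τ ^ 2) / τ by field_simp, le_div_iff₀ hτ]
    linarith
  -- The second point is taken on the side of the origin, so that it stays in the interval.
  rcases le_total x 0 with h0 | h0
  · exact key (x + τ) ⟨by linarith [hx.1], by linarith⟩ (by simp [abs_of_pos hτ])
  · exact key (x - τ) ⟨by linarith, by linarith [hx.2]⟩ (by simp [abs_of_pos hτ])

/-! ### Families of functions on `[-1, 1]` for the blow-up -/

section Families

variable {ι : Type*} {L : Filter ι} {u v : ι → ℝ → ℂ}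

/-- A family of functions tends to zero uniformly on `[-1, 1]`. -/
def Vanishing (L : Filter ι) (u : ι → ℝ → ℂ) : Prop :=
  ∀ ε > 0, ∀ᶠ i in L, ∀ y ∈ Icc (-1 : ℝ) 1, ‖u i y‖ ≤ ε

/-- A family of functions is bounded on `[-1, 1]`. -/
def BoundedFamily (u : ι → ℝ → ℂ) : Prop :=
  ∃ A, 0 ≤ A ∧ ∀ i, ∀ y ∈ Icc (-1 : ℝ) 1, ‖u i y‖ ≤ A

lemma BoundedFamily.add (hu : BoundedFamily u) (hv : BoundedFamily v) :
    BoundedFamily fun i y => u i y + v i y := by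
  obtain ⟨A, hA0, hA⟩ := hu
  obtain ⟨B, hB0, hB⟩ := hv
  exact ⟨A + B, by positivity, fun i y hy =>
    (norm_add_le _ _).trans (add_le_add (hA i y hy) (hB i y hy))⟩

lemma BoundedFamily.mul (hu : BoundedFamily u) (hv : BoundedFamily v) :
    BoundedFamily fun i y => u i y * v i y := by
  obtain ⟨A, hA0, hA⟩ := hu
  obtain ⟨B, hB0, hB⟩ := hv
  refine ⟨A * B, by positivity, fun i y hy => ?_⟩
  rw [norm_mul]
  exact mul_le_mul (hA i y hy) (hB i y hy) (norm_nonneg _) hA0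

lemma BoundedFamily.const_mul (hu : BoundedFamily u) (c : ℂ) :
    BoundedFamily fun i y => c * u i y := by
  obtain ⟨A, hA0, hA⟩ := hu
  refine ⟨‖c‖ * A, by positivity, fun i y hy => ?_⟩
  rw [norm_mul]
  gcongr
  exact hA i y hy

lemma Vanishing.add (hu : Vanishing L u) (hv : Vanishing L v) :
    Vanishing L fun i y => u i y + v i y := by
  intro ε hε
  filter_upwards [hu (ε / 2) (by positivity), hv (ε / 2) (by positivity)] with i h1 h2 y hy
  exact (norm_add_le _ _).trans (by linarith [h1 y hy, h2 y hy])

lemma Vanishing.mul_bounded (hu : Vanishing L u) (hv : BoundedFamily v) :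
    Vanishing L fun i y => u i y * v i y := by
  obtain ⟨B, hB0, hB⟩ := hv
  intro ε hε
  filter_upwards [hu (ε / (B + 1)) (by positivity)] with i h1 y hy
  rw [norm_mul]
  calc ‖u i y‖ * ‖v i y‖ ≤ ε / (B + 1) * B := mul_le_mul (h1 y hy) (hB i y hy)
        (norm_nonneg _) (by positivity)
    _ ≤ ε / (B + 1) * (B + 1) := by gcongr; linarith
    _ = ε := by field_simp

lemma Vanishing.const_mul (hu : Vanishing L u) (c : ℂ) : Vanishing L fun i y => c * u i y := by
  have h := hu.mul_bounded (v := fun _ _ => c) ⟨‖c‖, norm_nonneg _, fun _ _ _ => le_rfl⟩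
  simpa only [mul_comm] using h

lemma Vanishing.sub_zero (hu : Vanishing L u) : Vanishing L fun i y => u i y - u i 0 := by
  intro ε hε
  filter_upwards [hu (ε / 2) (by positivity)] with i h1 y hy
  exact (norm_sub_le _ _).trans (by linarith [h1 y hy, h1 0 (by simp)])

lemma Vanishing.tendsto (hu : Vanishing L u) : Tendsto (fun i => u i 0) L (𝓝 0) := by
  rw [Metric.tendsto_nhds]
  intro ε hε
  filter_upwards [hu (ε / 2) (by positivity)] with i h1
  rw [dist_zero_right]
  linarith [h1 0 (by simp)]

lemma vanishing_of_deriv {v' : ι → ℝ → ℂ} (hd : ∀ i y, HasDerivAt (v i) (v' i y) y)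
    (h : Vanishing L v') : Vanishing L fun i y => v i y - v i 0 := by
  intro ε hε
  filter_upwards [h ε hε] with i h1 y hy
  have h2 := (convex_Icc (-1 : ℝ) 1).norm_image_sub_le_of_norm_hasDerivWithin_le
    (fun x _ => (hd i x).hasDerivWithinAt) h1 (show (0 : ℝ) ∈ Icc (-1 : ℝ) 1 by simp) hy
  refine h2.trans ?_
  rw [_root_.sub_zero, Real.norm_eq_abs]
  have : |y| ≤ 1 := abs_le.2 hy
  nlinarith

/-- Landau's inequality: small oscillation together with a bounded second derivative forces a small
first derivative. -/
lemma vanishing_deriv {v v' v'' : ι → ℝ → ℂ} (hd : ∀ i y, HasDerivAt (v i) (v' i y) y)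
    (hd' : ∀ i y, HasDerivAt (v' i) (v'' i y) y) (hb : BoundedFamily v'')
    (h : Vanishing L fun i y => v i y - v i 0) : Vanishing L v' := by
  obtain ⟨A, hA0, hA⟩ := hb
  intro ε hε
  -- This makes the second order term `A * τ` at most `ε / 2`; oscillation at most `ε * τ / 4`
  -- contributes the other half.
  set τ : ℝ := min 1 (ε / (2 * (A + 1))) with hτ
  have hτ0 : 0 < τ := lt_min one_pos (by positivity)
  filter_upwards [h (ε * τ / 4) (by positivity)] with i h1 y hy
  refine (norm_deriv_le_of_oscillation (hd i) (hd' i) (hA i) h1 hτ0 (min_le_left _ _) hy).trans ?_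
  have h2 : 2 * (ε * τ / 4) / τ = ε / 2 := by field_simp; norm_num
  have h3 : A * τ ≤ ε / 2 := by
    calc A * τ ≤ (A + 1) * (ε / (2 * (A + 1))) := by
          gcongr
          · linarith
          · exact min_le_right _ _
      _ = ε / 2 := by field_simp
  linarith

/-- A family of solutions of the stationary KdV recursion that is bounded on `[-1, 1]`, has
potentials that tend to zero and first integrals that tend to zero, tends to the trivial one. -/
lemma tendsto_zero_of_vanishing_potential {n : ℕ} {U : ℕ → ℕ → ι → ℝ → ℂ} {W W' : ι → ℝ → ℂ}
    (hd : ∀ l k i y, HasDerivAt (U l k i) (U l (k + 1) i y) y)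
    (hW : ∀ i y, HasDerivAt (W i) (W' i y) y)
    (hU0 : ∀ i y, U 0 0 i y = 1) (hU1 : ∀ i y, U 0 1 i y = 0) (hU3 : ∀ i y, U 0 3 i y = 0)
    (hrec : ∀ l i y, U (l + 1) 1 i y = -(1 / 4) * U l 3 i y + W i y * U l 1 i y +
      (1 / 2) * W' i y * U l 0 i y)
    (hn : ∀ i y, U (n + 1) 1 i y = 0)
    (hb : ∀ l ≤ n, ∀ k ≤ 2, BoundedFamily (U l k)) (hWv : Vanishing L W) (hWb : BoundedFamily W)
    (hI : ∀ k < n, Tendsto (fun i =>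
      (∑ p ∈ Finset.HasAntidiagonal.antidiagonal k, ((1 / 2) * (U p.1 2 i 0 * U p.2 0 i 0)
        - (1 / 4) * (U p.1 1 i 0 * U p.2 1 i 0) - W i 0 * (U p.1 0 i 0 * U p.2 0 i 0))) +
      ∑ p ∈ Finset.HasAntidiagonal.antidiagonal (k + 1), U p.1 0 i 0 * U p.2 0 i 0) L (𝓝 0))
    {l k : ℕ} (hl1 : 1 ≤ l) (hln : l ≤ n) (hk : k ≤ 2) :
    Tendsto (fun i => U l k i 0) L (𝓝 0) := by
  -- Since `f_0 = 1`, the first step of the recursion reads `f_1' = W' / 2`, and `1 ≤ n` here.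
  have hW'b : BoundedFamily W' := by
    refine (congrArg BoundedFamily ?_).mp ((hb 1 (by omega) 1 (by omega)).const_mul 2)
    ext i y
    have := hrec 0 i y
    rw [hU0, hU1, hU3] at this
    rw [this]
    ring
  -- The recursion is solved for the third derivative; the term `U (l + 1) 1` that enters is zero
  -- when `l = n`.
  have hb3 : ∀ l ≤ n, BoundedFamily (U l 3) := by
    intro l hl
    have h1 : BoundedFamily (U (l + 1) 1) := by
      rcases hl.lt_or_eq with h | h
      · exact hb (l + 1) h 1 (by omega)
      · rw [h]
        exact ⟨0, le_rfl, fun i y _ => by rw [hn, norm_zero]⟩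
    have h2 := (((h1.const_mul (-1)).add (hWb.mul (hb l hl 1 (by omega)))).add
      ((hW'b.const_mul (1 / 2)).mul (hb l hl 0 (by omega)))).const_mul 4
    refine (congrArg BoundedFamily ?_).mp h2
    ext i y
    rw [hrec]
    ring
  have hstep : ∀ l ≤ n, Vanishing L (fun i y => U l 0 i y - U l 0 i 0) →
      Vanishing L (U l 1) ∧ Vanishing L (U l 2) := by
    intro l hl h
    have h1 := vanishing_deriv (hd l 0) (hd l 1) (hb l hl 2 le_rfl) h
    exact ⟨h1, vanishing_deriv (hd l 1) (hd l 2) (hb3 l hl) h1.sub_zero⟩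
  have hosc : ∀ l ≤ n, Vanishing L (fun i y => U l 0 i y - U l 0 i 0) := by
    intro l
    induction l with
    | zero =>
      intro _ ε hε
      filter_upwards with i y _
      rw [hU0, hU0, sub_self, norm_zero]
      exact hε.le
    | succ l ih =>
      intro hl
      obtain ⟨h1, h2⟩ := hstep l (by omega) (ih (by omega))
      have hb0 := hb l (by omega) 0 (by omega)
      have hb1 := hb l (by omega) 1 (by omega)
      -- The recursion in integrated form. `W'` is merely bounded, so its term is absorbed into the
      -- derivative of `(1/2) W f_l`; what remains, `(1/2) W f_l'`, tends to zero.
      have h3 := vanishing_of_deriv (L := L)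
        (v := fun i y => U (l + 1) 0 i y + (1 / 4) * U l 2 i y - (1 / 2) * (W i y * U l 0 i y))
        (v' := fun i y => (1 / 2) * (W i y * U l 1 i y)) (fun i y => ?_)
        ((hWv.mul_bounded hb1).const_mul _)
      · have h4 := (h3.add (h2.sub_zero.const_mul (-(1 / 4)))).add
          ((hWv.mul_bounded hb0).sub_zero.const_mul (1 / 2))
        refine (congrArg (Vanishing L) ?_).mp h4
        ext i y
        ring
      · refine (((hd (l + 1) 0 i y).add ((hd l 2 i y).const_mul (1 / 4 : ℂ))).sub
          (((hW i y).mul (hd l 0 i y)).const_mul (1 / 2 : ℂ))).congr_deriv ?_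
        rw [zero_add, hrec]
        ring
  have hv : ∀ l ≤ n, Vanishing L (U l 1) ∧ Vanishing L (U l 2) := fun l hl =>
    hstep l hl (hosc l hl)
  -- The recursion controls oscillations only. The values at the origin come from the first
  -- integrals: the `k`-th one contains `2 f_{k+1}`, and each of its other terms has a factor that
  -- tends to zero.
  have h0 : ∀ l, 1 ≤ l → l ≤ n → Tendsto (fun i => U l 0 i 0) L (𝓝 0) := by
    intro l
    induction l using Nat.strong_induction_on with
    | _ l ih =>
      intro hl1 hln
      obtain ⟨k, rfl⟩ : ∃ k, l = k + 1 := ⟨l - 1, by omega⟩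
      have hsum1 : Tendsto (fun i => ∑ p ∈ Finset.HasAntidiagonal.antidiagonal k,
          ((1 / 2) * (U p.1 2 i 0 * U p.2 0 i 0) - (1 / 4) * (U p.1 1 i 0 * U p.2 1 i 0) -
            W i 0 * (U p.1 0 i 0 * U p.2 0 i 0))) L (𝓝 0) := by
        rw [show (0 : ℂ) = ∑ p ∈ Finset.HasAntidiagonal.antidiagonal k,
          (((1 / 2 : ℂ) * 0 - (1 / 4 : ℂ) * 0) - 0) by simp]
        refine tendsto_finsetSum _ fun p hp => ?_
        rw [Finset.HasAntidiagonal.mem_antidiagonal] at hp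
        have hp1 : p.1 ≤ n := by omega
        have hp2 : p.2 ≤ n := by omega
        refine (((hv p.1 hp1).2.mul_bounded (hb p.2 hp2 0 (by omega))).tendsto.const_mul _).sub
          (((hv p.1 hp1).1.mul_bounded (hb p.2 hp2 1 (by omega))).tendsto.const_mul _) |>.sub ?_
        exact (hWv.mul_bounded ((hb p.1 hp1 0 (by omega)).mul (hb p.2 hp2 0 (by omega)))).tendsto
      have hsum2 : Tendsto (fun i => ∑ p ∈ (Finset.HasAntidiagonal.antidiagonal (k + 1)).filter
          (fun p => p.1 ≠ 0 ∧ p.2 ≠ 0), U p.1 0 i 0 * U p.2 0 i 0) L (𝓝 0) := by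
        rw [show (0 : ℂ) = ∑ p ∈ (Finset.HasAntidiagonal.antidiagonal (k + 1)).filter
          (fun p => p.1 ≠ 0 ∧ p.2 ≠ 0), (0 : ℂ) * 0 by simp]
        refine tendsto_finsetSum _ fun p hp => ?_
        rw [Finset.mem_filter, Finset.HasAntidiagonal.mem_antidiagonal] at hp
        exact (ih p.1 (by omega) (by omega) (by omega)).mul
          (ih p.2 (by omega) (by omega) (by omega))
      have h := (((hI k (by omega)).sub hsum1).sub hsum2).const_mul (1 / 2 : ℂ)
      simp only [sub_zero, mul_zero] at h
      refine h.congr fun i => ?_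
      rw [sum_antidiagonal_mul_self (fun l => U l 0 i 0), hU0]
      ring
  interval_cases k
  · exact h0 l hl1 hln
  · exact (hv l hln).1.tendsto
  · exact (hv l hln).2.tendsto

end Families

/-- A scale-invariant measure for the size of a solution of the stationary KdV recursion. -/
def solutionSize (f : ℕ → ℝ → ℂ) (n : ℕ) (x : ℝ) : ℝ :=
  ∑ q ∈ Finset.Icc 1 n ×ˢ Finset.range 3,
    ‖iteratedDeriv q.2 (f q.1) x‖ ^ ((2 * q.1 + q.2 : ℕ) : ℝ)⁻¹

lemma solutionSize_nonneg (f : ℕ → ℝ → ℂ) (n : ℕ) (x : ℝ) : 0 ≤ solutionSize f n x :=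
  Finset.sum_nonneg fun _ _ => Real.rpow_nonneg (norm_nonneg _) _

lemma continuous_solutionSize {f : ℕ → ℝ → ℂ} (hf : ∀ l, ContDiff ℝ ∞ (f l)) (n : ℕ) :
    Continuous (solutionSize f n) := by
  refine continuous_finsetSum _ fun q _ => ?_
  refine Continuous.rpow_const ?_ fun x => Or.inr (by positivity)
  exact ((hf q.1).continuous_iteratedDeriv q.2 (WithTop.coe_le_coe.2 le_top)).norm

lemma norm_iteratedDeriv_le_solutionSize {f : ℕ → ℝ → ℂ} {n l k : ℕ} (hl1 : 1 ≤ l) (hln : l ≤ n)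
    (hk : k ≤ 2) (x : ℝ) : ‖iteratedDeriv k (f l) x‖ ≤ solutionSize f n x ^ (2 * l + k) := by
  have h1 : ‖iteratedDeriv k (f l) x‖ ^ ((2 * l + k : ℕ) : ℝ)⁻¹ ≤ solutionSize f n x :=
    Finset.single_le_sum (f := fun q : ℕ × ℕ =>
        ‖iteratedDeriv q.2 (f q.1) x‖ ^ ((2 * q.1 + q.2 : ℕ) : ℝ)⁻¹)
      (fun _ _ => Real.rpow_nonneg (norm_nonneg _) _)
      (show (l, k) ∈ Finset.Icc 1 n ×ˢ Finset.range 3 by simp; omega)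
  calc ‖iteratedDeriv k (f l) x‖
      = (‖iteratedDeriv k (f l) x‖ ^ ((2 * l + k : ℕ) : ℝ)⁻¹) ^ (2 * l + k) :=
        (Real.rpow_inv_natCast_pow (norm_nonneg _) (by omega)).symm
    _ ≤ _ := by gcongr

/-- Solutions of the stationary KdV equation with bounded potential are bounded. -/
lemma SolvesStationaryKdV.exists_solutionSize_le {n : ℕ} {V : ℝ → ℂ} {f : ℕ → ℝ → ℂ}
    (hV : ContDiff ℝ ∞ V) (h : SolvesStationaryKdV n V f) {B : ℝ} (hB : ∀ x, ‖V x‖ ≤ B) :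
    ∃ M, ∀ x, solutionSize f n x ≤ M := by
  by_contra! hcon
  -- Centres for the blow-up: the size is large there and at most doubles within distance its own
  -- reciprocal.
  have hex : ∀ i : ℕ, ∃ x, (i : ℝ) + 2 ≤ solutionSize f n x ∧
      ∀ x', |x' - x| ≤ (solutionSize f n x)⁻¹ → solutionSize f n x' ≤ 2 * solutionSize f n x := by
    intro i
    obtain ⟨a, ha⟩ := hcon (i + 2)
    obtain ⟨x, hx, hx'⟩ := exists_scale (continuous_solutionSize h.1.contDiff n)
      (solutionSize_nonneg f n) (a := a) (by have : (0 : ℝ) ≤ i := i.cast_nonneg; linarith)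
    exact ⟨x, by linarith, hx'⟩
  choose X hX hdbl using hex
  set m : ℕ → ℝ := fun i => solutionSize f n (X i) with hm
  have hm2 : ∀ i, 2 ≤ m i := fun i => by
    have : (0 : ℝ) ≤ i := i.cast_nonneg
    linarith [hX i]
  set c : ℕ → ℝ := fun i => (m i)⁻¹ with hc
  have hc0 : ∀ i, 0 < c i := fun i => inv_pos.2 (by linarith [hm2 i])
  have hc1 : ∀ i, c i ≤ 1 := fun i => inv_le_one_of_one_le₀ (by linarith [hm2 i])
  have hclim : Tendsto c atTop (𝓝 0) := by
    refine tendsto_inv_atTop_zero.comp (tendsto_atTop_mono (fun i => ?_)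
      tendsto_natCast_atTop_atTop)
    have : (0 : ℝ) ≤ i := i.cast_nonneg
    linarith [hX i]
  have hccomp : ∀ i (y : ℝ), HasDerivAt (fun y => X i + c i * y) (c i) y := fun i y => by
    simpa using ((hasDerivAt_id y).const_mul (c i)).const_add (X i)
  -- The KdV scaling: with weight `2` for `V`, `2 l` for `f_l` and `1` for each `x`-derivative,
  -- zooming in preserves the recursion. The exponents in `solutionSize` are the reciprocals of
  -- these weights.
  set U : ℕ → ℕ → ℕ → ℝ → ℂ := fun l k i y =>
    (c i : ℂ) ^ (2 * l + k) * iteratedDeriv k (f l) (X i + c i * y) with hU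
  have key : ∀ l k, 1 ≤ l → l ≤ n → k ≤ 2 → Tendsto (fun i => U l k i 0) atTop (𝓝 0) := by
    intro l k hl1 hln hk
    have hpow : ∀ j : ℕ, j ≠ 0 → Tendsto (fun i => (c i : ℂ) ^ j) atTop (𝓝 0) := by
      intro j hj
      have := ((Complex.continuous_ofReal.tendsto 0).comp hclim).pow j
      rw [Complex.ofReal_zero, zero_pow hj] at this
      exact this
    refine tendsto_zero_of_vanishing_potential (n := n) (U := U)
      (W := fun i y => (c i : ℂ) ^ 2 * V (X i + c i * y))
      (W' := fun i y => (c i : ℂ) ^ 3 * iteratedDeriv 1 V (X i + c i * y))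
      ?_ ?_ ?_ ?_ ?_ ?_ ?_ ?_ ?_ ?_ ?_ hl1 hln hk
    · intro l k i y
      refine (((hasDerivAt_iteratedDeriv (h.1.contDiff l) k _).scomp y
        (hccomp i y)).const_mul ((c i : ℂ) ^ (2 * l + k))).congr_deriv ?_
      simp only [hU, Complex.real_smul]
      ring
    · intro i y
      refine (((hasDerivAt_of_contDiff hV _).scomp y
        (hccomp i y)).const_mul ((c i : ℂ) ^ 2)).congr_deriv ?_
      simp only [Complex.real_smul]
      ring
    · intro i y
      simp [hU, h.1.apply_zero]
    · intro i y
      simp only [hU, h.1.iteratedDeriv_one_zero, mul_zero]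
    · intro i y
      have h3 : iteratedDeriv 3 (f 0) (X i + c i * y) = 0 := by
        rw [show f 0 = fun _ => (1 : ℂ) from funext h.1.1]
        simp [iteratedDeriv_const]
      simp only [hU, h3, mul_zero]
    · intro l i y
      simp only [hU, h.1.recursion, iteratedDeriv_zero]
      ring
    · intro i y
      simp only [hU, h.iteratedDeriv_one_succ, mul_zero]
    · intro l hl k hk
      rcases Nat.eq_zero_or_pos l with rfl | hl0
      · refine ⟨1, zero_le_one, fun i y _ => ?_⟩
        interval_cases k
        · simp [hU, h.1.apply_zero]
        · simp only [hU, h.1.iteratedDeriv_one_zero, mul_zero, norm_zero, zero_le_one]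
        · simp only [hU, h.1.iteratedDeriv_two_zero, mul_zero, norm_zero, zero_le_one]
      -- The size is at most `2 * m i` on the zoomed interval, and `c i = (m i)⁻¹` cancels `m i`.
      · refine ⟨2 ^ (2 * l + k), by positivity, fun i y hy => ?_⟩
        have h1 : solutionSize f n (X i + c i * y) ≤ 2 * m i := by
          refine hdbl i _ ?_
          rw [add_sub_cancel_left, abs_mul, abs_of_pos (hc0 i)]
          exact mul_le_of_le_one_right (hc0 i).le (abs_le.2 hy)
        have hmi : 0 < m i := by linarith [hm2 i]
        simp only [hU]
        rw [norm_mul, norm_pow, Complex.norm_real, Real.norm_of_nonneg (hc0 i).le]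
        calc c i ^ (2 * l + k) * ‖iteratedDeriv k (f l) (X i + c i * y)‖
            ≤ c i ^ (2 * l + k) * (2 * m i) ^ (2 * l + k) := by
              refine mul_le_mul_of_nonneg_left ?_ (pow_nonneg (hc0 i).le _)
              exact (norm_iteratedDeriv_le_solutionSize hl0 hl hk _).trans
                (pow_le_pow_left₀ (solutionSize_nonneg _ _ _) h1 _)
          _ = 2 ^ (2 * l + k) := by
              rw [← mul_pow, hc]
              congr 1
              field_simp
    · intro ε hε
      have h2 : Tendsto (fun i => c i ^ 2 * B) atTop (𝓝 0) := by
        simpa using (hclim.pow 2).mul_const B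
      filter_upwards [h2.eventually_le_const hε] with i hi y _
      refine le_trans ?_ hi
      rw [norm_mul, norm_pow, Complex.norm_real, Real.norm_of_nonneg (hc0 i).le]
      gcongr
      exact hB _
    · refine ⟨B, (norm_nonneg _).trans (hB 0), fun i y _ => ?_⟩
      rw [norm_mul, norm_pow, Complex.norm_real, Real.norm_of_nonneg (hc0 i).le]
      have hB0 : 0 ≤ B := (norm_nonneg _).trans (hB 0)
      calc c i ^ 2 * ‖V (X i + c i * y)‖ ≤ 1 * B := by
            gcongr
            · exact pow_le_one₀ (hc0 i).le (hc1 i)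
            · exact hB _
        _ = B := one_mul B
    · intro k hk
      -- The coefficient of the first integral is the same number at all centres `X i`, so its
      -- rescaling by `c ^ (2 * k + 2)` tends to zero.
      have h1 := (hpow (2 * k + 2) (by omega)).mul_const (integralCoeff V f k 0)
      rw [zero_mul] at h1
      refine h1.congr fun i => ?_
      rw [h.1.integralCoeff_eq hV k 0 (X i), integralCoeff, mul_add, Finset.mul_sum,
        Finset.mul_sum]
      congr 1
      · refine Finset.sum_congr rfl fun p hp => ?_
        rw [Finset.HasAntidiagonal.mem_antidiagonal] at hp
        simp only [hU, ← hp, iteratedDeriv_zero, mul_zero, add_zero]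
        ring
      · refine Finset.sum_congr rfl fun p hp => ?_
        rw [Finset.HasAntidiagonal.mem_antidiagonal] at hp
        simp only [hU, show 2 * k + 2 = 2 * (p.1 + p.2) by omega, iteratedDeriv_zero, mul_zero,
          add_zero]
        ring
  -- By the choice of `c i`, the rescaled solution has size exactly one at the origin, which
  -- contradicts `key`.
  have hone : ∀ i, ∑ q ∈ Finset.Icc 1 n ×ˢ Finset.range 3,
      ‖U q.1 q.2 i 0‖ ^ ((2 * q.1 + q.2 : ℕ) : ℝ)⁻¹ = 1 := by
    intro i
    have hmi : m i ≠ 0 := by linarith [hm2 i]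
    calc _ = ∑ q ∈ Finset.Icc 1 n ×ˢ Finset.range 3,
          c i * ‖iteratedDeriv q.2 (f q.1) (X i)‖ ^ ((2 * q.1 + q.2 : ℕ) : ℝ)⁻¹ := by
          refine Finset.sum_congr rfl fun q hq => ?_
          simp only [Finset.mem_product, Finset.mem_Icc] at hq
          simp only [hU, mul_zero, add_zero]
          rw [norm_mul, norm_pow, Complex.norm_real, Real.norm_of_nonneg (hc0 i).le,
            Real.mul_rpow (pow_nonneg (hc0 i).le _) (norm_nonneg _),
            Real.pow_rpow_inv_natCast (hc0 i).le (by omega)]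
      _ = c i * m i := by rw [← Finset.mul_sum]; rfl
      _ = 1 := inv_mul_cancel₀ hmi
  have hzero : Tendsto (fun i => ∑ q ∈ Finset.Icc 1 n ×ˢ Finset.range 3,
      ‖U q.1 q.2 i 0‖ ^ ((2 * q.1 + q.2 : ℕ) : ℝ)⁻¹) atTop (𝓝 0) := by
    refine (tendsto_finsetSum _ fun q hq => ?_).trans_eq
      (congrArg 𝓝 (Finset.sum_const_zero (s := Finset.Icc 1 n ×ˢ Finset.range 3)))
    simp only [Finset.mem_product, Finset.mem_Icc, Finset.mem_range] at hq
    have h1 := (key q.1 q.2 hq.1.1 hq.1.2 (by omega)).norm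
    rw [norm_zero] at h1
    have hpos : (0 : ℝ) < ((2 * q.1 + q.2 : ℕ) : ℝ)⁻¹ := by
      have : 0 < 2 * q.1 + q.2 := by omega
      positivity
    have h2 := h1.rpow_const (p := ((2 * q.1 + q.2 : ℕ) : ℝ)⁻¹) (Or.inr hpos.le)
    rwa [Real.zero_rpow hpos.ne'] at h2
  simp only [hone] at hzero
  exact one_ne_zero (tendsto_nhds_unique tendsto_const_nhds hzero)

/-! ### Almost periodicity of the solutions -/

namespace SolvesStationaryKdV

variable {n : ℕ} {V : ℝ → ℂ} {f : ℕ → ℝ → ℂ}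

/-- `solutionSize` controls orders up to two. The recursion then bounds `V'` through `f_1' = V' /
2`, and after that the third derivatives. -/
lemma exists_norm_iteratedDeriv_le (hV : ContDiff ℝ ∞ V) (h : SolvesStationaryKdV n V f) {B : ℝ}
    (hB : ∀ x, ‖V x‖ ≤ B) :
    ∃ A, 0 ≤ A ∧ ∀ l ≤ n, ∀ k ≤ 3, ∀ x, ‖iteratedDeriv k (f l) x‖ ≤ A := by
  obtain ⟨M, hM⟩ := h.exists_solutionSize_le hV hB
  set D := max M 1 ^ (2 * n + 2) with hD
  have hD1 : 1 ≤ D := one_le_pow₀ (le_max_right _ _)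
  have hB0 : 0 ≤ B := (norm_nonneg _).trans (hB 0)
  have h2 : ∀ l ≤ n, ∀ k ≤ 2, ∀ x, ‖iteratedDeriv k (f l) x‖ ≤ D := by
    intro l hl k hk x
    rcases Nat.eq_zero_or_pos l with rfl | hl0
    · interval_cases k
      · simpa [h.1.apply_zero] using hD1
      · rw [h.1.iteratedDeriv_one_zero, norm_zero]
        positivity
      · rw [h.1.iteratedDeriv_two_zero, norm_zero]
        positivity
    · calc _ ≤ solutionSize f n x ^ (2 * l + k) := norm_iteratedDeriv_le_solutionSize hl0 hl hk x
        _ ≤ max M 1 ^ (2 * l + k) := pow_le_pow_left₀ (solutionSize_nonneg _ _ _)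
            ((hM x).trans (le_max_left _ _)) _
        _ ≤ D := pow_le_pow_right₀ (le_max_right _ _) (by omega)
  have h1 : ∀ l ≤ n, ∀ x, ‖iteratedDeriv 1 (f (l + 1)) x‖ ≤ D := by
    intro l hl x
    rcases hl.lt_or_eq with hl | rfl
    · exact h2 (l + 1) hl 1 (by omega) x
    · rw [h.iteratedDeriv_one_succ, norm_zero]
      positivity
  have hV' : ∀ x, ‖(1 / 2) * iteratedDeriv 1 V x‖ ≤ D := by
    intro x
    have h3 : iteratedDeriv 3 (f 0) x = 0 := by
      rw [show f 0 = fun _ => (1 : ℂ) from funext h.1.1]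
      simp [iteratedDeriv_const]
    have := h1 0 (by omega) x
    rw [h.1.recursion, h.1.iteratedDeriv_one_zero, h.1.apply_zero, h3] at this
    simpa using this
  refine ⟨4 * (D + B * D + D * D) + D, by positivity, fun l hl k hk x => ?_⟩
  rcases hk.lt_or_eq with hk | rfl
  · have := h2 l hl k (by omega) x
    have : 0 ≤ 4 * (D + B * D + D * D) := by positivity
    linarith
  · have e : iteratedDeriv 3 (f l) x = 4 * (-iteratedDeriv 1 (f (l + 1)) x +
        V x * iteratedDeriv 1 (f l) x + ((1 / 2) * iteratedDeriv 1 V x) * f l x) := by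
      rw [h.1.recursion]
      ring
    have hf0 : ‖f l x‖ ≤ D := by simpa using h2 l hl 0 (by omega) x
    rw [e, norm_mul, Complex.norm_ofNat]
    calc 4 * _ ≤ 4 * (D + B * D + D * D) := by
          refine mul_le_mul_of_nonneg_left ((norm_add₃_le).trans ?_) (by norm_num)
          rw [norm_neg, norm_mul, norm_mul _ (f l x)]
          gcongr
          exacts [h1 l hl x, hB x, h2 l hl 1 (by omega) x, hV' x]
      _ ≤ _ := by linarith

/-- The `k`-th first integral, constant in `x`, expresses `f_{k+1}` polynomially through `V`, `f_j`,
`f_j'`, `f_j''` with `j ≤ k`, so no antiderivative has to be almost periodic. The derivatives are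
almost periodic because those up to order three are bounded. -/
lemma isAlmostPeriodic (hV : ContDiff ℝ ∞ V) (h : SolvesStationaryKdV n V f)
    (hVap : IsAlmostPeriodic V) {l : ℕ} (hl : l ≤ n) : IsAlmostPeriodic (f l) := by
  obtain ⟨B, hB⟩ := hVap.bounded
  obtain ⟨A, -, hA⟩ := h.exists_norm_iteratedDeriv_le hV hB
  have hder : ∀ l ≤ n, IsAlmostPeriodic (f l) →
      IsAlmostPeriodic (iteratedDeriv 1 (f l)) ∧ IsAlmostPeriodic (iteratedDeriv 2 (f l)) := by
    intro l hl hap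
    have h1 := hap.of_hasDerivAt (hasDerivAt_of_contDiff (h.1.contDiff l))
      (hasDerivAt_iteratedDeriv (h.1.contDiff l) 1) (hA l hl 2 (by omega))
    exact ⟨h1, h1.of_hasDerivAt (hasDerivAt_iteratedDeriv (h.1.contDiff l) 1)
      (hasDerivAt_iteratedDeriv (h.1.contDiff l) 2) (hA l hl 3 le_rfl)⟩
  induction l using Nat.strong_induction_on with
  | _ l ih =>
    rcases Nat.eq_zero_or_pos l with rfl | hl0
    · rw [show f 0 = fun _ => (1 : ℂ) from funext h.1.1]
      exact IsAlmostPeriodic.const 1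
    obtain ⟨k, rfl⟩ : ∃ k, l = k + 1 := ⟨l - 1, by omega⟩
    have hsum1 : IsAlmostPeriodic fun x => ∑ p ∈ Finset.HasAntidiagonal.antidiagonal k,
        ((1 / 2) * (iteratedDeriv 2 (f p.1) x * f p.2 x)
          - (1 / 4) * (iteratedDeriv 1 (f p.1) x * iteratedDeriv 1 (f p.2) x)
          - V x * (f p.1 x * f p.2 x)) := by
      refine IsAlmostPeriodic.sum fun p hp => ?_
      rw [Finset.HasAntidiagonal.mem_antidiagonal] at hp
      have a1 := ih p.1 (by omega) (by omega)
      have a2 := ih p.2 (by omega) (by omega)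
      have b1 := hder p.1 (by omega) a1
      have b2 := hder p.2 (by omega) a2
      exact (((b1.2.mul a2).const_mul _).sub ((b1.1.mul b2.1).const_mul _)).sub
        (hVap.mul (a1.mul a2))
    have hsum2 : IsAlmostPeriodic fun x =>
        ∑ p ∈ (Finset.HasAntidiagonal.antidiagonal (k + 1)).filter
          (fun p => p.1 ≠ 0 ∧ p.2 ≠ 0), f p.1 x * f p.2 x := by
      refine IsAlmostPeriodic.sum fun p hp => ?_
      rw [Finset.mem_filter, Finset.HasAntidiagonal.mem_antidiagonal] at hp
      exact (ih p.1 (by omega) (by omega)).mul (ih p.2 (by omega) (by omega))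
    refine (congrArg IsAlmostPeriodic ?_).mp
      ((((IsAlmostPeriodic.const (integralCoeff V f k 0)).sub hsum1).sub hsum2).const_mul (1 / 2))
    ext x
    rw [h.1.integralCoeff_eq hV k 0 x, integralCoeff,
      sum_antidiagonal_mul_self (fun l => f l x), h.1.apply_zero]
    ring

end SolvesStationaryKdV

/-! ### The polynomials `F_n(·,x)` -/

lemma F_eq_pow_add {f : ℕ → ℝ → ℂ} (h0 : ∀ x, f 0 x = 1) (n : ℕ) (z : ℂ) (x : ℝ) :
    F f n z x = ∑ l ∈ Finset.range n, f (n - l) x * z ^ l + z ^ n := by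
  rw [F, Finset.sum_range_succ, Nat.sub_self, h0, one_mul]

/-- Cauchy's bound for the zeros of a monic polynomial, uniform in `x` because the coefficients are.
-/
lemma exists_zerosBoundedBy {f : ℕ → ℝ → ℂ} (h0 : ∀ x, f 0 x = 1) {n : ℕ} {A : ℝ} (hA0 : 0 ≤ A)
    (hA : ∀ l ≤ n, ∀ x, ‖f l x‖ ≤ A) : ∃ C : ℝ, 0 < C ∧ ZerosBoundedBy f n C := by
  refine ⟨n * A + 1, by positivity, fun x μ hμ => ?_⟩
  by_contra! hlt
  have hnA : 0 ≤ n * A := by positivity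
  have h1 : 1 ≤ ‖μ‖ := by linarith
  rw [F_eq_pow_add h0, add_comm, add_eq_zero_iff_eq_neg] at hμ
  have h2 : ‖μ‖ ^ n ≤ ∑ l ∈ Finset.range n, A * ‖μ‖ ^ l := by
    rw [← norm_pow, hμ, norm_neg]
    refine norm_sum_le_of_le _ fun l _ => ?_
    rw [norm_mul, norm_pow]
    gcongr
    exact hA _ (by omega) x
  rcases Nat.eq_zero_or_pos n with rfl | hn
  · norm_num at h2
  · obtain ⟨k, rfl⟩ : ∃ k, n = k + 1 := ⟨n - 1, by omega⟩
    have h3 : ∑ l ∈ Finset.range (k + 1), A * ‖μ‖ ^ l ≤ (k + 1 : ℕ) * A * ‖μ‖ ^ k := by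
      calc _ ≤ ∑ l ∈ Finset.range (k + 1), A * ‖μ‖ ^ k := by
            refine Finset.sum_le_sum fun l hl => ?_
            have := Finset.mem_range.1 hl
            gcongr
            omega
        _ = _ := by simp; ring
    have h4 := h2.trans h3
    rw [pow_succ, mul_comm] at h4
    have h5 : ‖μ‖ ≤ (k + 1 : ℕ) * A := le_of_mul_le_mul_right h4 (by positivity)
    linarith

open Polynomial in
-- The polynomial is monic and `z` has distance at least one from each of its zeros, so every linear
-- factor has modulus at least one. This is the role of the radius `C + 1`.
lemma one_le_norm_F {f : ℕ → ℝ → ℂ} (h0 : ∀ x, f 0 x = 1) {n : ℕ} {C : ℝ}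
    (hC : ZerosBoundedBy f n C) {z : ℂ} (hz : C + 1 ≤ ‖z‖) (x : ℝ) : 1 ≤ ‖F f n z x‖ := by
  set q : ℂ[X] := ∑ l : Fin n, Polynomial.C (f (n - l) x) * X ^ (l : ℕ) with hq
  have hdeg : q.degree < n := Polynomial.degree_sum_fin_lt fun l : Fin n => f (n - l) x
  have heval : ∀ w, (X ^ n + q).eval w = F f n w x := by
    intro w
    rw [F_eq_pow_add h0, hq, eval_add, eval_finsetSum, Finset.sum_range, add_comm]
    simp
  have hm : (X ^ n + q).Monic := monic_X_pow_add hdeg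
  rw [← heval, (IsAlgClosed.splits _).eval_eq_prod_roots_of_monic hm,
    ← coe_nnnorm, ← NNReal.coe_one, NNReal.coe_le_coe]
  have hprod := map_multiset_prod (nnnormHom : ℂ →*₀ NNReal)
    (Multiset.map (fun a => z - a) (X ^ n + q).roots)
  rw [Multiset.map_map] at hprod
  refine le_of_le_of_eq ?_ hprod.symm
  refine Multiset.one_le_prod_map fun a ha => ?_
  have ha' : F f n a x = 0 := by
    rw [← heval]
    exact (mem_roots hm.ne_zero).1 ha
  have h1 := hC x a ha'
  have h2 := norm_sub_norm_le z a
  change (1 : NNReal) ≤ ‖z - a‖₊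
  rw [← NNReal.coe_le_coe, coe_nnnorm, NNReal.coe_one]
  linarith

/-! ### The mean value of the diagonal Green's function -/

/-- `∑ ⟨f_{n-ℓ}⟩ z^ℓ`, the mean value of `F_n(z,·)`. -/
def meanF (f : ℕ → ℝ → ℂ) (n : ℕ) (z : ℂ) : ℂ :=
  ∑ l ∈ Finset.range (n + 1), meanValue (f (n - l)) * z ^ l

section Mean

variable {n : ℕ} {f : ℕ → ℝ → ℂ}

lemma isAlmostPeriodic_F (hf : ∀ l ≤ n, IsAlmostPeriodic (f l)) (z : ℂ) :
    IsAlmostPeriodic (F f n z) :=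
  IsAlmostPeriodic.sum fun l _ => (hf (n - l) (by omega)).mul (IsAlmostPeriodic.const (z ^ l))

lemma hasMeanValue_F (hf : ∀ l ≤ n, IsAlmostPeriodic (f l)) (z : ℂ) :
    HasMeanValue (F f n z) (meanF f n z) := by
  have h := HasMeanValue.sum (s := Finset.range (n + 1))
    (fun l _ => (hf (n - l) (by omega)).hasMeanValue.const_mul (z ^ l))
    fun l _ => continuous_const.mul (hf (n - l) (by omega)).continuous
  simp only [mul_comm (z ^ _)] at h
  exact h

lemma isAlmostPeriodic_g (hf : ∀ l ≤ n, IsAlmostPeriodic (f l)) (S : ℂ → ℂ) (z : ℂ) :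
    IsAlmostPeriodic (g f n S z) := by
  refine (congrArg IsAlmostPeriodic ?_).mp
    ((isAlmostPeriodic_F hf z).const_mul (Complex.I / (2 * S z)))
  ext x
  rw [g]
  ring

lemma meanG_eq (hf : ∀ l ≤ n, IsAlmostPeriodic (f l)) (S : ℂ → ℂ) (z : ℂ) :
    meanG f n S z = Complex.I / (2 * S z) * meanF f n z := by
  refine HasMeanValue.meanValue_eq ?_
  refine (congrArg (HasMeanValue · _) ?_).mp
    ((hasMeanValue_F hf z).const_mul (Complex.I / (2 * S z)))
  ext x
  rw [g]
  ring

lemma differentiable_meanF (f : ℕ → ℝ → ℂ) (n : ℕ) : Differentiable ℂ (meanF f n) := by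
  unfold meanF
  fun_prop

lemma differentiableOn_meanG (hf : ∀ l ≤ n, IsAlmostPeriodic (f l)) {S : ℂ → ℂ} {U : Set ℂ}
    (hS : DifferentiableOn ℂ S U) (hS0 : ∀ z ∈ U, S z ≠ 0) :
    DifferentiableOn ℂ (meanG f n S) U := by
  rw [funext (meanG_eq hf S)]
  refine DifferentiableOn.mul ?_ (differentiable_meanF f n).differentiableOn
  exact (differentiableOn_const _).div (hS.const_mul 2) fun z hz =>
    mul_ne_zero two_ne_zero (hS0 z hz)

end Mean

/-! ### The derivative of the mean value of the reciprocal of the Green's function -/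

/-- A uniform bound for the second order Taylor remainder of a bounded holomorphic function. -/
lemma exists_taylor_bound {B r : ℝ} (hr : 0 < r) (c : ℂ) : ∃ K : ℝ, ∀ φ : ℂ → ℂ,
    DifferentiableOn ℂ φ (Metric.ball c r) → (∀ z ∈ Metric.ball c r, ‖φ z‖ ≤ B) →
    ∀ z ∈ Metric.ball c r, ‖φ z - φ c - (z - c) * deriv φ c‖ ≤ K * ‖z - c‖ ^ 2 := by
  -- Schwarz's lemma twice: `φ - φ c` is bounded by `2 * B`, so the difference quotient is bounded
  -- by `2 * B / r`, and the same argument applies to it. The constant depends on `B` and `r` only,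
  -- which later gives uniformity in `x`.
  refine ⟨2 * (2 * B / r) / r, fun φ hφ hB z hz => ?_⟩
  have hc : c ∈ Metric.ball c r := Metric.mem_ball_self hr
  have hnhds : Metric.ball c r ∈ 𝓝 c := Metric.ball_mem_nhds c hr
  have hd : DifferentiableOn ℂ (dslope φ c) (Metric.ball c r) :=
    (Complex.differentiableOn_dslope hnhds).2 hφ
  have h1 : ∀ w ∈ Metric.ball c r, ‖dslope φ c w‖ ≤ 2 * B / r := fun w hw => by
    refine Complex.norm_dslope_le_div_of_mapsTo_ball hφ (fun v hv => ?_) hw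
    rw [Metric.mem_closedBall, dist_eq_norm]
    exact (norm_sub_le _ _).trans (by linarith [hB v hv, hB c hc])
  have h2 : ‖dslope (dslope φ c) c z‖ ≤ 2 * (2 * B / r) / r := by
    refine Complex.norm_dslope_le_div_of_mapsTo_ball hd (fun v hv => ?_) hz
    rw [Metric.mem_closedBall, dist_eq_norm]
    exact (norm_sub_le _ _).trans (by linarith [h1 v hv, h1 c hc])
  have e1 := sub_smul_dslope φ c z
  have e2 := sub_smul_dslope (dslope φ c) c z
  rw [dslope_same] at e2
  simp only [smul_eq_mul] at e1 e2
  have e3 : φ z - φ c - (z - c) * deriv φ c =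
      (z - c) * ((z - c) * dslope (dslope φ c) c z) := by
    rw [e2, mul_sub, e1]
  rw [e3, norm_mul, norm_mul]
  nlinarith [mul_le_mul_of_nonneg_right h2 (sq_nonneg ‖z - c‖)]

lemma hasDerivAt_of_quadratic_bound {φ : ℂ → ℂ} {c D : ℂ} {K r : ℝ} (hr : 0 < r)
    (h : ∀ z ∈ Metric.ball c r, ‖φ z - φ c - (z - c) * D‖ ≤ K * ‖z - c‖ ^ 2) :
    HasDerivAt φ D c := by
  rw [hasDerivAt_iff_isLittleO]
  refine Asymptotics.IsBigO.trans_isLittleO ?_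
    (Asymptotics.isLittleO_pow_sub_sub c (m := 2) one_lt_two)
  refine Asymptotics.IsBigO.of_bound K ?_
  filter_upwards [Metric.ball_mem_nhds c hr] with z hz
  rw [smul_eq_mul, norm_pow, norm_norm]
  exact h z hz

section InvG

variable {n : ℕ} {V : ℝ → ℂ} {f : ℕ → ℝ → ℂ} {S : ℂ → ℂ} {U : Set ℂ}

/-- The `z`-derivative of the first integral. -/
lemma sqrt_mul_deriv (hf : ∀ l, ContDiff ℝ ∞ (f l)) (hU : IsOpen U) (hS : DifferentiableOn ℂ S U)
    (hR : ∀ z ∈ U, ∀ x, S z ^ 2 = firstIntegral V f n z x) {z : ℂ} (hz : z ∈ U) (x : ℝ) :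
    2 * S z * deriv S z = (1 / 2) * (FderZ f n 2 z x * Fder f n 0 z x +
        Fder f n 2 z x * FderZ f n 0 z x) - (1 / 2) * (Fder f n 1 z x * FderZ f n 1 z x) +
      Fder f n 0 z x ^ 2 - 2 * (V x - z) * (Fder f n 0 z x * FderZ f n 0 z x) := by
  have h1 : HasDerivAt (fun w => S w ^ 2) (2 * S z * deriv S z) z := by
    have := ((hS.differentiableAt (hU.mem_nhds hz)).hasDerivAt).fun_pow 2
    simpa using this
  have d := fun j => hasDerivAt_Fder_z f n j z x
  have h2 := ((((d 2).const_mul (1 / 2 : ℂ)).mul (d 0)).sub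
    (((d 1).pow 2).const_mul (1 / 4 : ℂ))).sub
    (((hasDerivAt_id z).const_sub (V x)).mul ((d 0).pow 2))
  have h3 : (fun w => S w ^ 2) =ᶠ[𝓝 z] fun w => (1 / 2) * Fder f n 2 w x * Fder f n 0 w x -
      (1 / 4) * Fder f n 1 w x ^ 2 - (V x - w) * Fder f n 0 w x ^ 2 := by
    filter_upwards [hU.mem_nhds hz] with w hw
    rw [hR w hw x, firstIntegral_eq hf]
  rw [(h1.congr_of_eventuallyEq h3.symm).unique h2]
  simp only [id, Nat.cast_ofNat, Pi.pow_apply]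
  ring

/-- `∂_z g⁻¹ = -2 g + ∂_x T` with `T = i (∂_z F ∂_x F / F - ∂_z ∂_x F) / (2 R^{1/2})`. -/
lemma hasDerivAt_inv_g (hf : ∀ l, ContDiff ℝ ∞ (f l)) (hU : IsOpen U)
    (hS : DifferentiableOn ℂ S U) (hR : ∀ z ∈ U, ∀ x, S z ^ 2 = firstIntegral V f n z x)
    {z : ℂ} (hz : z ∈ U) (hS0 : S z ≠ 0) {x : ℝ} (hF : F f n z x ≠ 0) :
    HasDerivAt (fun w => (g f n S w x)⁻¹) (-2 * g f n S z x + Complex.I / (2 * S z) *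
      ((FderZ f n 1 z x * Fder f n 1 z x + FderZ f n 0 z x * Fder f n 2 z x) / Fder f n 0 z x -
        FderZ f n 0 z x * Fder f n 1 z x ^ 2 / Fder f n 0 z x ^ 2 - FderZ f n 2 z x)) z := by
  have hS1 := (hS.differentiableAt (hU.mem_nhds hz)).hasDerivAt
  have hg : ∀ w, (g f n S w x)⁻¹ = -2 * Complex.I * (S w / Fder f n 0 w x) := by
    intro w
    rw [g, Fder_zero, inv_div, mul_comm Complex.I, ← div_div, div_eq_mul_inv _ Complex.I,
      Complex.inv_I]
    ring
  rw [funext hg]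
  rw [← Fder_zero] at hF
  have hI := Complex.I_ne_zero
  refine ((hS1.fun_div (hasDerivAt_Fder_z f n 0 z x) hF).const_mul
    (-2 * Complex.I)).congr_deriv ?_
  -- `e1` eliminates the derivative of the root and `e2` its square.
  have e1 := sqrt_mul_deriv hf hU hS hR hz x
  have e2 := hR z hz x
  rw [firstIntegral_eq hf] at e2
  rw [g, ← Fder_zero]
  field_simp
  linear_combination (-2 * Fder f n 0 z x) * e1 + (4 * FderZ f n 0 z x) * e2

lemma exists_norm_Fder_le {A : ℝ} (hA : ∀ l ≤ n, ∀ k ≤ 3, ∀ x, ‖iteratedDeriv k (f l) x‖ ≤ A)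
    {j : ℕ} (hj : j ≤ 3) (z : ℂ) :
    ∃ B, ∀ x, ‖Fder f n j z x‖ ≤ B ∧ ‖FderZ f n j z x‖ ≤ B := by
  refine ⟨max (∑ l ∈ Finset.range (n + 1), A * ‖z ^ l‖)
    (∑ l ∈ Finset.range (n + 1), A * ‖l * z ^ (l - 1)‖), fun x => ⟨?_, ?_⟩⟩
  · refine le_max_of_le_left (norm_sum_le_of_le _ fun l _ => ?_)
    rw [norm_mul]
    gcongr
    exact hA _ (by omega) _ hj x
  · refine le_max_of_le_right (norm_sum_le_of_le _ fun l _ => ?_)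
    rw [norm_mul]
    gcongr
    exact hA _ (by omega) _ hj x

lemma continuous_of_hasDerivAt {u u' : ℝ → ℂ} (h : ∀ x, HasDerivAt u (u' x) x) : Continuous u :=
  continuous_iff_continuousAt.2 fun x => (h x).continuousAt

/-- The mean value of the total derivative in `∂_z g⁻¹` vanishes. -/
lemma hasMeanValue_correction (hf : ∀ l, ContDiff ℝ ∞ (f l)) {A : ℝ}
    (hA : ∀ l ≤ n, ∀ k ≤ 3, ∀ x, ‖iteratedDeriv k (f l) x‖ ≤ A) {z : ℂ}
    (hF : ∀ x, 1 ≤ ‖F f n z x‖) (c : ℂ) :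
    Continuous (fun x => c * ((FderZ f n 1 z x * Fder f n 1 z x +
        FderZ f n 0 z x * Fder f n 2 z x) / Fder f n 0 z x -
        FderZ f n 0 z x * Fder f n 1 z x ^ 2 / Fder f n 0 z x ^ 2 - FderZ f n 2 z x)) ∧
    HasMeanValue (fun x => c * ((FderZ f n 1 z x * Fder f n 1 z x +
        FderZ f n 0 z x * Fder f n 2 z x) / Fder f n 0 z x -
        FderZ f n 0 z x * Fder f n 1 z x ^ 2 / Fder f n 0 z x ^ 2 - FderZ f n 2 z x)) 0 := by
  rw [← Fder_zero] at hF
  have hF0 : ∀ x, Fder f n 0 z x ≠ 0 := fun x hx => by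
    have := hF x
    rw [hx, norm_zero] at this
    linarith
  have d := hasDerivAt_Fder hf n
  have dz := hasDerivAt_FderZ hf n
  have c1 := fun j => continuous_of_hasDerivAt (d j z)
  have c2 := fun j => continuous_of_hasDerivAt (dz j z)
  have hcont : Continuous (fun x => c * ((FderZ f n 1 z x * Fder f n 1 z x +
        FderZ f n 0 z x * Fder f n 2 z x) / Fder f n 0 z x -
        FderZ f n 0 z x * Fder f n 1 z x ^ 2 / Fder f n 0 z x ^ 2 - FderZ f n 2 z x)) := by
    have c10 := c1 0
    have c11 := c1 1
    have c12 := c1 2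
    have c20 := c2 0
    have c21 := c2 1
    have c22 := c2 2
    refine continuous_const.mul (((Continuous.div (by fun_prop) c10 hF0).sub
      (Continuous.div (by fun_prop) (by fun_prop) fun x => pow_ne_zero 2 (hF0 x))).sub c22)
  refine ⟨hcont, ?_⟩
  obtain ⟨B0, hB0⟩ := exists_norm_Fder_le hA (show 0 ≤ 3 by omega) z
  obtain ⟨B1, hB1⟩ := exists_norm_Fder_le hA (show 1 ≤ 3 by omega) z
  have hB0' : 0 ≤ B0 := (norm_nonneg _).trans (hB0 0).1
  -- The function is the `x`-derivative of `T`, in which the quotient is bounded by its numerator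
  -- because `1 ≤ |F|`.
  refine hasMeanValue_deriv_of_bounded (B := ‖c‖ * (B0 * B1 + B1))
    (T := fun x => c * (FderZ f n 0 z x * Fder f n 1 z x / Fder f n 0 z x - FderZ f n 1 z x))
    (fun x => ?_) hcont fun x => ?_
  · refine (((((dz 0 z x).mul (d 1 z x)).div (d 0 z x) (hF0 x)).sub (dz 1 z x)).const_mul
      c).congr_deriv ?_
    have := hF0 x
    simp only [zero_add, Pi.mul_apply]
    field_simp
  · rw [norm_mul]
    refine mul_le_mul_of_nonneg_left ((norm_sub_le _ _).trans ?_) (norm_nonneg _)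
    refine add_le_add ?_ (hB1 x).2
    rw [norm_div, norm_mul]
    refine (div_le_self (by positivity) (hF x)).trans ?_
    exact mul_le_mul (hB0 x).2 (hB1 x).1 (norm_nonneg _) hB0'

lemma isAlmostPeriodic_inv_g (hap : ∀ l ≤ n, IsAlmostPeriodic (f l)) {z : ℂ} (hS0 : S z ≠ 0)
    (hF : ∀ x, 1 ≤ ‖F f n z x‖) : IsAlmostPeriodic fun x => (g f n S z x)⁻¹ := by
  have hpos : 0 < ‖2 * S z‖ := norm_pos_iff.2 (mul_ne_zero two_ne_zero hS0)
  refine (isAlmostPeriodic_g hap S z).inv (δ := 1 / ‖2 * S z‖) (by positivity) fun x => ?_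
  rw [g, norm_div, norm_mul Complex.I, Complex.norm_I, one_mul]
  gcongr
  exact hF x

/-- `d⟨g⁻¹⟩/dz = -2⟨g⟩`. -/
lemma hasDerivAt_meanInvG (hf : ∀ l, ContDiff ℝ ∞ (f l)) (hap : ∀ l ≤ n, IsAlmostPeriodic (f l))
    {A : ℝ} (hA : ∀ l ≤ n, ∀ k ≤ 3, ∀ x, ‖iteratedDeriv k (f l) x‖ ≤ A) (hU : IsOpen U)
    (hS : DifferentiableOn ℂ S U) (hR : ∀ z ∈ U, ∀ x, S z ^ 2 = firstIntegral V f n z x)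
    (hS0 : ∀ z ∈ U, S z ≠ 0) (hF : ∀ z ∈ U, ∀ x, 1 ≤ ‖F f n z x‖) {c : ℂ} (hc : c ∈ U) :
    HasDerivAt (meanInvG f n S) (-2 * meanG f n S c) c := by
  obtain ⟨r, hr, hrU⟩ := Metric.nhds_basis_closedBall.mem_iff.1 (hU.mem_nhds hc)
  have hbU : Metric.ball c r ⊆ U := Metric.ball_subset_closedBall.trans hrU
  obtain ⟨B, hB⟩ := (isCompact_closedBall c r).exists_bound_of_continuousOn
    (hS.continuousOn.mono hrU)
  -- On the disc `|g⁻¹| = 2 |S| / |F| ≤ 2 * B` for every `x`, so one constant `K` serves all `x`.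
  obtain ⟨K, hK⟩ := exists_taylor_bound (B := 2 * B) hr c
  have hF0 : ∀ z ∈ U, ∀ x, F f n z x ≠ 0 := fun z hz x hx => by
    have := hF z hz x
    rw [hx, norm_zero] at this
    linarith
  have hder := fun z (hz : z ∈ U) x =>
    hasDerivAt_inv_g hf hU hS hR hz (hS0 z hz) (hF0 z hz x)
  have hmean : ∀ z ∈ U, HasMeanValue (fun x => (g f n S z x)⁻¹) (meanInvG f n S z) := fun z hz =>
    (isAlmostPeriodic_inv_g hap (hS0 z hz) (hF z hz)).hasMeanValue
  have hcont : ∀ z ∈ U, Continuous fun x => (g f n S z x)⁻¹ := fun z hz =>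
    (isAlmostPeriodic_inv_g hap (hS0 z hz) (hF z hz)).continuous
  obtain ⟨ccorr, hcorr⟩ := hasMeanValue_correction hf hA (hF c hc) (Complex.I / (2 * S c))
  have hgap := isAlmostPeriodic_g hap S c
  have hcont' : Continuous fun x => deriv (fun w => (g f n S w x)⁻¹) c := by
    rw [funext fun x => (hder c hc x).deriv]
    exact (continuous_const.mul hgap.continuous).add ccorr
  have hmean' : HasMeanValue (fun x => deriv (fun w => (g f n S w x)⁻¹) c)
      (-2 * meanG f n S c) := by
    rw [funext fun x => (hder c hc x).deriv, ← add_zero (-2 * meanG f n S c)]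
    exact (hgap.hasMeanValue.const_mul (-2)).add hcorr (continuous_const.mul hgap.continuous) ccorr
  -- Mean values are linear and bounded by the sup norm, so the uniform remainder estimate carries
  -- over to them.
  refine hasDerivAt_of_quadratic_bound hr (K := K) fun z hz => ?_
  refine HasMeanValue.norm_le (((hmean z (hbU hz)).sub (hmean c hc) (hcont z (hbU hz))
    (hcont c hc)).sub (hmean'.const_mul (z - c)) ((hcont z (hbU hz)).sub (hcont c hc))
    (continuous_const.mul hcont')) fun x => ?_
  refine hK (fun w => (g f n S w x)⁻¹) (fun w hw =>
    (hder w (hbU hw) x).differentiableAt.differentiableWithinAt) (fun w hw => ?_) z hz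
  rw [g, norm_inv, norm_div, norm_mul, Complex.norm_I, one_mul, inv_div, norm_mul,
    Complex.norm_ofNat]
  refine (div_le_self (by positivity) (hF w (hbU hw) x)).trans ?_
  gcongr
  exact hB w (Metric.ball_subset_closedBall hw)

end InvG

/-! ### Topology of the cut plane -/

namespace CutSystem

variable {n : ℕ} {E : Fin (2 * n + 1) → ℂ} (K : CutSystem n E)

/-- The ray finally leaves the unit disc about `z`, so near `z` only a compact initial piece
matters. -/
lemma isClosed_ray : IsClosed (K.ray '' Ici 0) := by
  refine isClosed_of_closure_subset fun z hz => ?_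
  have hev : ∀ᶠ t in atTop, K.ray t ∈ (Metric.closedBall z 1)ᶜ :=
    K.ray_tendsto.eventually (isCompact_closedBall z 1).compl_mem_cocompact
  obtain ⟨T, hT⟩ := eventually_atTop.1 hev
  have hcomp : IsCompact (K.ray '' Icc 0 T) :=
    isCompact_Icc.image_of_continuousOn (K.ray_continuous.mono Icc_subset_Ici_self)
  refine image_mono Icc_subset_Ici_self (hcomp.isClosed.closure_subset ?_)
  rw [mem_closure_iff_nhds] at hz ⊢
  intro s hs
  obtain ⟨w, ⟨hws, hwb⟩, t, ht, rfl⟩ :=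
    hz (s ∩ Metric.closedBall z 1) (inter_mem hs (Metric.closedBall_mem_nhds z one_pos))
  refine ⟨K.ray t, hws, t, ⟨ht, ?_⟩, rfl⟩
  by_contra! hlt
  exact hT t hlt.le hwb

lemma isClosed_cuts : IsClosed K.cuts :=
  (isClosed_iUnion_of_finite fun j =>
    (isCompact_Icc.image_of_continuousOn (K.arc_continuous j)).isClosed).union K.isClosed_ray

lemma isOpen_plane : IsOpen K.plane := K.isClosed_cuts.isOpen_compl

lemma isOpen_outerPlane (C : ℝ) : IsOpen (K.outerPlane C) := by
  refine K.isOpen_plane.sdiff (IsClosed.union (isClosed_le continuous_norm continuous_const) ?_)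
  exact (isClosed_le continuous_const Complex.continuous_re).inter
    ((isClosed_le continuous_const Complex.continuous_im).inter
      (isClosed_le Complex.continuous_im continuous_const))

/-- Counting: disjointness and injectivity make the `2 n` end points of the arcs and the initial
point of the ray distinct, so they exhaust the `2 n + 1` indices. Consequently the root has no zeros
in `Π`. -/
lemma branchPoint_mem_cuts (m : Fin (2 * n + 1)) : E m ∈ K.cuts := by
  let ψ : Fin n ⊕ Fin n ⊕ Unit → Fin (2 * n + 1) :=
    Sum.elim K.first (Sum.elim K.second fun _ => Fin.last (2 * n))
  have hfst : ∀ j, E (K.first j) ∈ K.arc j '' Icc 0 1 := fun j => ⟨0, by simp, K.arc_zero j⟩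
  have hsnd : ∀ j, E (K.second j) ∈ K.arc j '' Icc 0 1 := fun j => ⟨1, by simp, K.arc_one j⟩
  have hlast : E (Fin.last (2 * n)) ∈ K.ray '' Ici 0 := ⟨0, by simp, K.ray_zero⟩
  have hjk : ∀ {j k z}, z ∈ K.arc j '' Icc 0 1 → z ∈ K.arc k '' Icc 0 1 → j = k := by
    intro j k z hj hk
    by_contra hne
    exact disjoint_left.1 (K.arc_disjoint_arc j k hne) hj hk
  have hne : ∀ j k, K.first j ≠ K.second k := by
    intro j k h
    have h1 := hfst j
    rw [h] at h1
    obtain rfl := hjk h1 (hsnd k)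
    have h2 : K.arc j 0 = K.arc j 1 := by rw [K.arc_zero, K.arc_one, h]
    exact zero_ne_one (K.arc_injective j (by simp) (by simp) h2)
  have hψ : Function.Injective ψ := by
    rintro (j | j | _) (k | k | _) h
    · have h1 := hfst j
      rw [show K.first j = K.first k from h] at h1
      rw [hjk h1 (hfst k)]
    · exact (hne j k h).elim
    · have h1 := hfst j
      rw [show K.first j = Fin.last (2 * n) from h] at h1
      exact (disjoint_left.1 (K.arc_disjoint_ray j) h1 hlast).elim
    · exact (hne k j h.symm).elim
    · have h1 := hsnd j
      rw [show K.second j = K.second k from h] at h1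
      rw [hjk h1 (hsnd k)]
    · have h1 := hsnd j
      rw [show K.second j = Fin.last (2 * n) from h] at h1
      exact (disjoint_left.1 (K.arc_disjoint_ray j) h1 hlast).elim
    · have h1 := hfst k
      rw [show K.first k = Fin.last (2 * n) from h.symm] at h1
      exact (disjoint_left.1 (K.arc_disjoint_ray k) h1 hlast).elim
    · have h1 := hsnd k
      rw [show K.second k = Fin.last (2 * n) from h.symm] at h1
      exact (disjoint_left.1 (K.arc_disjoint_ray k) h1 hlast).elim
    · rfl
  have hbij : Function.Bijective ψ := by
    rw [Fintype.bijective_iff_injective_and_card]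
    refine ⟨hψ, ?_⟩
    simp
    ring
  obtain ⟨j | j | _, rfl⟩ := hbij.2 m
  · exact Or.inl (mem_iUnion.2 ⟨j, hfst j⟩)
  · exact Or.inl (mem_iUnion.2 ⟨j, hsnd j⟩)
  · exact Or.inr hlast

end CutSystem

/-! ### Integration along piecewise continuously differentiable paths -/

/-- At the end points `deriv γ` may be the default value zero, so the derivative is used in the
interior only. Integrability comes from `derivWithin`, which is continuous on the closed interval.
-/
lemma integral_of_no_breaks {D A : ℝ → ℂ} {γ : ℝ → ℂ} {a b : ℝ} (hab : a < b)
    (hγ : ContDiffOn ℝ 1 γ (Icc a b)) (hD : ContinuousOn D (Icc a b))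
    (hA : ContinuousOn A (Icc a b))
    (hA' : ∀ t ∈ Ioo a b, ∀ v, HasDerivAt γ v t → HasDerivAt A (D t * v) t) :
    IntervalIntegrable (fun u => D u * deriv γ u) MeasureTheory.volume a b ∧
      A b - A a = ∫ u in a..b, D u * deriv γ u := by
  have hint : IntervalIntegrable (fun u => D u * deriv γ u) MeasureTheory.volume a b := by
    have h1 : ContinuousOn (fun u => D u * derivWithin γ (Icc a b) u) (Icc a b) :=
      hD.mul (hγ.continuousOn_derivWithin (uniqueDiffOn_Icc hab) le_rfl)
    rw [intervalIntegrable_iff_integrableOn_Ioo_of_le hab.le]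
    refine (h1.integrableOn_Icc.mono_set Ioo_subset_Icc_self).congr_fun (fun u hu => ?_)
      measurableSet_Ioo
    simp only [derivWithin_of_mem_nhds (Icc_mem_nhds hu.1 hu.2)]
  refine ⟨hint, (intervalIntegral.integral_eq_sub_of_hasDerivAt_of_le hab.le hA (fun t ht => ?_)
    hint).symm⟩
  have hdiff : DifferentiableAt ℝ γ t := (hγ.differentiableOn one_ne_zero t
    (Ioo_subset_Icc_self ht)).differentiableAt (Icc_mem_nhds ht.1 ht.2)
  exact hA' t ht _ hdiff.hasDerivAt

/-- The fundamental theorem of calculus along a piecewise `C¹` path: `A` is given, locally along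
the path, by primitives of `D`. -/
lemma sub_eq_pathIntegral {D : ℂ → ℂ} {γ : ℝ → ℂ} {a b : ℝ} (hab : a ≤ b)
    (hγ : IsPiecewiseC1On γ a b) (hD : ∀ t ∈ Icc a b, ContinuousAt D (γ t)) {A : ℝ → ℂ}
    (hA : ∀ t ∈ Icc a b, ∃ P : ℂ → ℂ, HasDerivAt P (D (γ t)) (γ t) ∧
      ∀ᶠ s in 𝓝[Icc a b] t, A s = P (γ s)) :
    A b - A a = pathIntegral D γ a b := by
  obtain ⟨hcont, Q, hQ⟩ := hγ
  -- Induction on the set of break points, for all subintervals at once: splitting at an interior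
  -- break point removes it from both halves.
  suffices H : ∀ Q : Finset ℝ, ∀ a' b', a ≤ a' → a' ≤ b' → b' ≤ b →
      (∀ c d : ℝ, a' ≤ c → c < d → d ≤ b' → (∀ p ∈ Q, p ∉ Ioo c d) →
        ContDiffOn ℝ 1 γ (Icc c d)) →
      IntervalIntegrable (fun u => D (γ u) * deriv γ u) MeasureTheory.volume a' b' ∧
        A b' - A a' = ∫ u in a'..b', D (γ u) * deriv γ u from
    (H Q a b le_rfl hab le_rfl hQ).2
  intro Q
  induction Q using Finset.strongInduction with
  | H Q ih =>
    intro a' b' ha hab' hb hQ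
    rcases hab'.eq_or_lt with rfl | hlt
    · simp
    by_cases hp : ∃ p ∈ Q, p ∈ Ioo a' b'
    · obtain ⟨p, hpQ, hp⟩ := hp
      have hss : Q.erase p ⊂ Q := Finset.erase_ssubset hpQ
      obtain ⟨i1, e1⟩ := ih _ hss a' p ha hp.1.le (hp.2.le.trans hb) fun c d hc hcd hd hcond =>
        hQ c d hc hcd (hd.trans hp.2.le) fun q hq => by
          by_cases hqp : q = p
          · subst hqp
            exact fun h => absurd h.2 (not_lt.2 hd)
          · exact hcond q (Finset.mem_erase.2 ⟨hqp, hq⟩)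
      obtain ⟨i2, e2⟩ := ih _ hss p b' (ha.trans hp.1.le) hp.2.le hb fun c d hc hcd hd hcond =>
        hQ c d (hp.1.le.trans hc) hcd hd fun q hq => by
          by_cases hqp : q = p
          · subst hqp
            exact fun h => absurd h.1 (not_lt.2 hc)
          · exact hcond q (Finset.mem_erase.2 ⟨hqp, hq⟩)
      refine ⟨i1.trans i2, ?_⟩
      rw [← intervalIntegral.integral_add_adjacent_intervals i1 i2, ← e1, ← e2]
      ring
    · push Not at hp
      have hsub : Icc a' b' ⊆ Icc a b := Icc_subset_Icc ha hb
      refine integral_of_no_breaks hlt (hQ a' b' le_rfl hlt le_rfl hp)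
        (fun t ht => (hD t (hsub ht)).comp_continuousWithinAt ((hcont t (hsub ht)).mono hsub))
        (fun t ht => ?_) fun t ht v hv => ?_
      · obtain ⟨P, hP, hAP⟩ := hA t (hsub ht)
        have h1 : ContinuousWithinAt (fun s => P (γ s)) (Icc a b) t :=
          hP.continuousAt.comp_continuousWithinAt (hcont t (hsub ht))
        exact (h1.congr_of_eventuallyEq hAP (hAP.self_of_nhdsWithin (hsub ht))).mono hsub
      · obtain ⟨P, hP, hAP⟩ := hA t (hsub (Ioo_subset_Icc_self ht))
        rw [nhdsWithin_eq_nhds.2 (Icc_mem_nhds (ha.trans_lt ht.1) (ht.2.trans_le hb))] at hAP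
        exact (hP.comp t hv).congr_of_eventuallyEq hAP

lemma pathIntegral_const_mul (c : ℂ) (D : ℂ → ℂ) (γ : ℝ → ℂ) (s t : ℝ) :
    pathIntegral (fun z => c * D z) γ s t = c * pathIntegral D γ s t := by
  simp only [pathIntegral, mul_assoc, intervalIntegral.integral_const_mul]

/-! ### Analytic continuation of primitives -/

/-- `φ` is a primitive of `D` near `z`. -/
def IsPrimitiveNear (D φ : ℂ → ℂ) (z : ℂ) : Prop := ∀ᶠ w in 𝓝 z, HasDerivAt φ (D w) w

lemma IsPrimitiveNear.hasDerivAt {D φ : ℂ → ℂ} {z : ℂ} (h : IsPrimitiveNear D φ z) :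
    HasDerivAt φ (D z) z := h.self_of_nhds

/-- Turns the notion into an equality of analytic germs, to which the identity theorem applies. -/
lemma isPrimitiveNear_iff {D φ : ℂ → ℂ} {z : ℂ} (h : AnalyticAt ℂ φ z) :
    IsPrimitiveNear D φ z ↔ deriv φ =ᶠ[𝓝 z] D := by
  constructor
  · intro hp
    filter_upwards [hp] with w hw using hw.deriv
  · intro hp
    filter_upwards [hp, h.eventually_analyticAt] with w hw ha
    rw [← hw]
    exact ha.differentiableAt.hasDerivAt

lemma IsPrimitiveNear.congr {D φ ψ : ℂ → ℂ} {z : ℂ} (h : IsPrimitiveNear D φ z)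
    (hφ : ψ =ᶠ[𝓝 z] φ) : IsPrimitiveNear D ψ z := by
  filter_upwards [h, hφ.eventuallyEq_nhds] with w hw hw' using hw.congr_of_eventuallyEq hw'

/-- Primitives differ locally by a constant. -/
lemma IsPrimitiveNear.eventually_sub_eq {D φ ψ : ℂ → ℂ} {z : ℂ} (hφ : IsPrimitiveNear D φ z)
    (hψ : IsPrimitiveNear D ψ z) : ∀ᶠ w in 𝓝 z, φ w - ψ w = φ z - ψ z := by
  obtain ⟨r, hr, hball⟩ := Metric.eventually_nhds_iff_ball.1 (hφ.and hψ)
  filter_upwards [Metric.ball_mem_nhds z hr] with w hw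
  have hd : ∀ v ∈ Metric.ball z r, HasDerivAt (fun v => φ v - ψ v) 0 v := fun v hv => by
    simpa using (hball v hv).1.fun_sub (hball v hv).2
  exact Metric.isOpen_ball.is_const_of_deriv_eq_zero (convex_ball z r).isPreconnected
    (fun v hv => (hd v hv).differentiableAt.differentiableWithinAt) (fun v hv => (hd v hv).deriv)
    hw (Metric.mem_ball_self hr)

/-- Analytic functions that agree near some point close to `z` agree near `z`. -/
lemma eventually_eventuallyEq_iff {φ ψ : ℂ → ℂ} {z : ℂ} (hφ : AnalyticAt ℂ φ z)
    (hψ : AnalyticAt ℂ ψ z) : ∀ᶠ w in 𝓝 z, (φ =ᶠ[𝓝 z] ψ ↔ φ =ᶠ[𝓝 w] ψ) := by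
  obtain ⟨r, hr, hball⟩ := Metric.eventually_nhds_iff_ball.1
    (hφ.eventually_analyticAt.and hψ.eventually_analyticAt)
  by_cases h : φ =ᶠ[𝓝 z] ψ
  · filter_upwards [h.eventuallyEq_nhds] with w hw
    exact ⟨fun _ => hw, fun _ => h⟩
  · filter_upwards [Metric.ball_mem_nhds z hr] with w hw
    refine ⟨fun h' => absurd h' h, fun hw' => ?_⟩
    have heq : EqOn φ ψ (Metric.ball z r) :=
      AnalyticOnNhd.eqOn_of_preconnected_of_eventuallyEq (fun v hv => (hball v hv).1)
        (fun v hv => (hball v hv).2) (convex_ball z r).isPreconnected hw hw'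
    exact heq.eventuallyEq_of_mem (Metric.ball_mem_nhds z hr)

namespace IsContinuationAlong

variable {φ D : ℂ → ℂ} {γ : ℝ → ℂ} {I J : Set ℝ} {Φ Ψ : ℝ → ℂ → ℂ}

lemma mono (h : IsContinuationAlong φ γ I Φ) (hJ : J ⊆ I) : IsContinuationAlong φ γ J Φ :=
  ⟨fun t ht => h.1 t (hJ ht), fun t ht => nhdsWithin_mono t hJ (h.2.1 t (hJ ht)), h.2.2⟩

/-- The continuation of a primitive consists of primitives. -/
lemma isPrimitiveNear (h : IsContinuationAlong φ γ I Φ) (hI : IsPreconnected I) (h0 : 0 ∈ I)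
    (hγ : ContinuousOn γ I) (hD : ∀ t ∈ I, AnalyticAt ℂ D (γ t))
    (hφ : IsPrimitiveNear D φ (γ 0)) {t : ℝ} (ht : t ∈ I) : IsPrimitiveNear D (Φ t) (γ t) := by
  -- Being a primitive is locally constant in the parameter: neighbouring germs agree, and by the
  -- identity theorem `deriv (Φ x)` equals `D` near `γ x` if and only if it does near a close point.
  -- Connectedness spreads it.
  refine (hI.induction₂ (fun s t => IsPrimitiveNear D (Φ s) (γ s) ↔ IsPrimitiveNear D (Φ t) (γ t))
    (fun x hx => ?_) (fun _ _ _ _ _ _ => Iff.trans) (fun _ _ _ _ => Iff.symm) h0 ht).1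
    (hφ.congr h.2.2)
  have h1 := (hγ x hx).eventually (eventually_eventuallyEq_iff (h.1 x hx).deriv (hD x hx))
  filter_upwards [h.2.1 x hx, h1, self_mem_nhdsWithin] with y hy hy1 hyI
  rw [isPrimitiveNear_iff (h.1 x hx), isPrimitiveNear_iff (h.1 y hyI), hy1]
  exact ⟨fun e => hy.deriv.trans e, fun e => hy.deriv.symm.trans e⟩

/-- Uniqueness of analytic continuation along a path. -/
lemma unique (h : IsContinuationAlong φ γ I Φ) (h' : IsContinuationAlong φ γ I Ψ)
    (hI : IsPreconnected I) (h0 : 0 ∈ I) (hγ : ContinuousOn γ I) {t : ℝ} (ht : t ∈ I) :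
    Φ t =ᶠ[𝓝 (γ t)] Ψ t := by
  refine (hI.induction₂ (fun s t => Φ s =ᶠ[𝓝 (γ s)] Ψ s ↔ Φ t =ᶠ[𝓝 (γ t)] Ψ t)
    (fun x hx => ?_) (fun _ _ _ _ _ _ => Iff.trans) (fun _ _ _ _ => Iff.symm) h0 ht).1
    (h.2.2.trans h'.2.2.symm)
  have h1 := (hγ x hx).eventually (eventually_eventuallyEq_iff (h.1 x hx) (h'.1 x hx))
  filter_upwards [h.2.1 x hx, h'.2.1 x hx, h1] with y hy hy' hy1
  rw [hy1]
  exact ⟨fun e => (hy.trans e).trans hy'.symm, fun e => (hy.symm.trans e).trans hy'⟩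

/-- Along a piece of the path on which `D` has a single-valued primitive `G`, the continuation
differs from `G` by a constant. -/
lemma sub_primitive_eq (h : IsContinuationAlong φ γ I Φ) (hJI : J ⊆ I) (hJ : IsPreconnected J)
    (hγ : ContinuousOn γ J) (hΦ : ∀ t ∈ J, IsPrimitiveNear D (Φ t) (γ t)) {G : ℂ → ℂ}
    (hG : ∀ t ∈ J, IsPrimitiveNear D G (γ t)) {s t : ℝ} (hs : s ∈ J) (ht : t ∈ J) :
    Φ s (γ s) - G (γ s) = Φ t (γ t) - G (γ t) := by
  refine hJ.induction₂ (fun s t => Φ s (γ s) - G (γ s) = Φ t (γ t) - G (γ t))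
    (fun x hx => ?_) (fun _ _ _ _ _ _ => Eq.trans) (fun _ _ _ _ => Eq.symm) hs ht
  filter_upwards [nhdsWithin_mono x hJI (h.2.1 x (hJI hx)),
    (hγ x hx).eventually ((hΦ x hx).eventually_sub_eq (hG x hx))] with y hy hy'
  rw [hy.eq_of_nhds, hy']

/-- A continuation can be prolonged along a piece of the path on which `D` has a primitive. -/
lemma prolong {s₁ s₂ : ℝ} (h : IsContinuationAlong φ γ (Icc 0 s₁) Φ) (hs₁ : 0 ≤ s₁)
    (hs : s₁ < s₂) (hγ : ContinuousOn γ (Icc 0 s₂)) {W : Set ℂ} (hW : IsOpen W)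
    (hγW : ∀ t ∈ Icc s₁ s₂, γ t ∈ W) {G : ℂ → ℂ} (hG : ∀ z ∈ W, HasDerivAt G (D z) z)
    (hΦ : IsPrimitiveNear D (Φ s₁) (γ s₁)) :
    ∃ Ψ, IsContinuationAlong φ γ (Icc 0 s₂) Ψ := by
  -- The constant is chosen such that `G'` and `Φ s₁` have the same germ at `γ s₁`.
  set G' : ℂ → ℂ := fun z => G z + (Φ s₁ (γ s₁) - G (γ s₁)) with hG'
  have hGan : AnalyticOnNhd ℂ G' W := DifferentiableOn.analyticOnNhd
    (fun z hz => ((hG z hz).add_const _).differentiableAt.differentiableWithinAt) hW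
  have hs₁W : γ s₁ ∈ W := hγW s₁ ⟨le_rfl, hs.le⟩
  have heq : G' =ᶠ[𝓝 (γ s₁)] Φ s₁ := by
    have hGp : IsPrimitiveNear D G (γ s₁) := by
      filter_upwards [hW.mem_nhds hs₁W] with z hz using hG z hz
    filter_upwards [hΦ.eventually_sub_eq hGp] with z hz
    rw [hG', ← hz]
    ring
  refine ⟨fun u => if u ≤ s₁ then Φ u else G', fun t ht => ?_, fun t ht => ?_, ?_⟩
  · by_cases hts : t ≤ s₁
    · simp only [if_pos hts]
      exact h.1 t ⟨ht.1, hts⟩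
    · simp only [if_neg hts]
      exact hGan _ (hγW t ⟨(not_le.1 hts).le, ht.2⟩)
  · rcases lt_trichotomy t s₁ with hts | rfl | hts
    · have h1 := eventually_nhdsWithin_iff.1 (h.2.1 t ⟨ht.1, hts.le⟩)
      rw [eventually_nhdsWithin_iff]
      filter_upwards [h1, eventually_lt_nhds hts] with u hu hus huI
      simp only [if_pos hts.le, if_pos hus.le]
      exact hu ⟨huI.1, hus.le⟩
    · have h1 := eventually_nhdsWithin_iff.1 (h.2.1 t ⟨ht.1, le_rfl⟩)
      have h2 := eventually_nhdsWithin_iff.1 ((hγ t ht).eventually heq.eventuallyEq_nhds)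
      rw [eventually_nhdsWithin_iff]
      filter_upwards [h1, h2] with u hu hu2 huI
      by_cases hut : u ≤ t
      · simp only [if_pos hut, if_pos le_rfl]
        exact hu ⟨huI.1, hut⟩
      · simp only [if_neg hut, if_pos le_rfl]
        exact hu2 huI
    · filter_upwards [nhdsWithin_le_nhds (eventually_gt_nhds hts)] with u hu
      simp only [if_neg (not_le.2 hts), if_neg (not_le.2 hu)]
      exact EventuallyEq.rfl
  · simp only [if_pos hs₁]
    exact h.2.2

end IsContinuationAlong

section Existence

variable {φ D : ℂ → ℂ} {γ : ℝ → ℂ} {U : Set ℂ}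

/-- Whether the continuation reaches the parameter `s` is locally constant in `s`, since a short
piece of the path lies in a disc in `U`, where `D` has a primitive. Connectedness concludes. -/
lemma exists_continuation_Icc {b : ℝ} (hb : 0 ≤ b) (hU : IsOpen U) (hD : DifferentiableOn ℂ D U)
    (hγ : ContinuousOn γ (Icc 0 b)) (hγU : ∀ t ∈ Icc 0 b, γ t ∈ U) (hφ : AnalyticAt ℂ φ (γ 0))
    (hφD : IsPrimitiveNear D φ (γ 0)) : ∃ Φ, IsContinuationAlong φ γ (Icc 0 b) Φ := by
  have hDan : AnalyticOnNhd ℂ D U := hD.analyticOnNhd hU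
  have h00 : ∃ Φ, IsContinuationAlong φ γ (Icc 0 0) Φ := by
    refine ⟨fun _ => φ, fun t ht => ?_, fun t ht => ?_, EventuallyEq.rfl⟩
    · rw [Icc_self, mem_singleton_iff] at ht
      rwa [ht]
    · exact Eventually.of_forall fun _ => EventuallyEq.rfl
  refine (isPreconnected_Icc.induction₂ (s := Icc 0 b)
    (fun s t => (∃ Φ, IsContinuationAlong φ γ (Icc 0 s) Φ) ↔
      ∃ Φ, IsContinuationAlong φ γ (Icc 0 t) Φ)
    (fun x hx => ?_) (fun _ _ _ _ _ _ => Iff.trans) (fun _ _ _ _ => Iff.symm)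
    (left_mem_Icc.2 hb) (right_mem_Icc.2 hb)).1 h00
  obtain ⟨r, hr, hrU⟩ := Metric.isOpen_iff.1 hU (γ x) (hγU x hx)
  obtain ⟨G, hG⟩ := (hD.mono hrU).isExactOn_ball
  obtain ⟨ε, hε, hεγ⟩ := Metric.continuousWithinAt_iff.1 (hγ x hx) r hr
  have key : ∀ s ∈ Icc 0 b, ∀ t ∈ Icc 0 b, dist s x < ε → dist t x < ε →
      (∃ Φ, IsContinuationAlong φ γ (Icc 0 s) Φ) → ∃ Φ, IsContinuationAlong φ γ (Icc 0 t) Φ := by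
    rintro s hs t ht hsx htx ⟨Φ, hΦ⟩
    rcases le_or_gt t s with hts | hst
    · exact ⟨Φ, hΦ.mono (Icc_subset_Icc_right hts)⟩
    · refine hΦ.prolong hs.1 hst (hγ.mono (Icc_subset_Icc_right ht.2)) Metric.isOpen_ball
        (fun u hu => hεγ ⟨hs.1.trans hu.1, hu.2.trans ht.2⟩ ?_) hG
        (hΦ.isPrimitiveNear isPreconnected_Icc (left_mem_Icc.2 hs.1)
          (hγ.mono (Icc_subset_Icc_right hs.2))
          (fun u hu => hDan _ (hγU u ⟨hu.1, hu.2.trans hs.2⟩)) hφD (right_mem_Icc.2 hs.1))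
      rw [Real.dist_eq, abs_lt] at hsx htx ⊢
      constructor <;> linarith [hu.1, hu.2, hsx.1, htx.2]
  filter_upwards [self_mem_nhdsWithin, nhdsWithin_le_nhds (Metric.ball_mem_nhds x hε)] with y hy hyε
  have hxx : dist x x < ε := by rwa [dist_self]
  exact ⟨key x hx y hy hxx hyε, key y hy x hx hyε hxx⟩

/-- The continuations on the intervals `[0, b]`, `b < 1`, are compatible by uniqueness, so their
germs at the right end points form one continuation. -/
lemma exists_continuation_Ico (hU : IsOpen U) (hD : DifferentiableOn ℂ D U)
    (hγ : ContinuousOn γ (Ico 0 1)) (hγU : ∀ t ∈ Ico (0 : ℝ) 1, γ t ∈ U)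
    (hφ : AnalyticAt ℂ φ (γ 0)) (hφD : IsPrimitiveNear D φ (γ 0)) :
    ∃ Φ, IsContinuationAlong φ γ (Ico 0 1) Φ := by
  have hsub : ∀ {b : ℝ}, b < 1 → Icc 0 b ⊆ Ico 0 1 := fun hb u hu => ⟨hu.1, hu.2.trans_lt hb⟩
  have hex : ∀ b : ℝ, ∃ Φ, b ∈ Ico (0 : ℝ) 1 → IsContinuationAlong φ γ (Icc 0 b) Φ := by
    intro b
    by_cases hb : b ∈ Ico (0 : ℝ) 1
    · obtain ⟨Φ, hΦ⟩ := exists_continuation_Icc hb.1 hU hD (hγ.mono (hsub hb.2))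
        (fun t ht => hγU t (hsub hb.2 ht)) hφ hφD
      exact ⟨Φ, fun _ => hΦ⟩
    · exact ⟨fun _ => φ, fun h => absurd h hb⟩
  choose Ξ hΞ using hex
  have hcmp : ∀ s b, 0 ≤ s → s ≤ b → b < 1 → Ξ s s =ᶠ[𝓝 (γ s)] Ξ b s := by
    intro s b hs hsb hb
    exact (hΞ s ⟨hs, hsb.trans_lt hb⟩).unique
      ((hΞ b ⟨hs.trans hsb, hb⟩).mono (Icc_subset_Icc_right hsb)) isPreconnected_Icc
      (left_mem_Icc.2 hs) (hγ.mono (hsub (hsb.trans_lt hb))) (right_mem_Icc.2 hs)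
  refine ⟨fun t => Ξ t t, fun t ht => (hΞ t ht).1 t (right_mem_Icc.2 ht.1), fun t ht => ?_,
    (hΞ 0 (by simp)).2.2⟩
  obtain ⟨b, htb, hb⟩ := exists_between ht.2
  have h1 := eventually_nhdsWithin_iff.1 ((hΞ b ⟨ht.1.trans htb.le, hb⟩).2.1 t ⟨ht.1, htb.le⟩)
  have h2 : ∀ᶠ s in 𝓝[Ico 0 1] t, Ξ b t =ᶠ[𝓝 (γ s)] Ξ t t :=
    (hγ t ht).eventually (hcmp t b ht.1 htb.le hb).symm.eventuallyEq_nhds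
  filter_upwards [nhdsWithin_le_nhds h1, nhdsWithin_le_nhds (eventually_lt_nhds htb),
    self_mem_nhdsWithin, h2] with s hs hsb hsI hs2
  exact ((hcmp s b hsI.1 hsb.le hb).trans (hs ⟨hsI.1, hsb.le⟩)).trans hs2

end Existence

/-! ### Primitives near the cuts -/

/-- `Q / Q p` is close to one near `p`, inside the domain of the principal branch. -/
lemma exists_local_sqrt {Q : ℂ → ℂ} (hQ : Differentiable ℂ Q) {p : ℂ} (hp : Q p ≠ 0) :
    ∃ δ > 0, ∃ q : ℂ → ℂ, DifferentiableOn ℂ q (Metric.ball p δ) ∧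
      ∀ z ∈ Metric.ball p δ, q z ^ 2 = Q z ∧ q z ≠ 0 := by
  obtain ⟨c, hc⟩ := IsAlgClosed.exists_pow_nat_eq (Q p) (n := 2) two_pos
  have hcont : ContinuousAt (fun z => Q z / Q p) p := (hQ.continuous.div_const _).continuousAt
  have hmem : ∀ᶠ z in 𝓝 p, Q z / Q p ∈ Complex.slitPlane :=
    hcont.eventually (Complex.isOpen_slitPlane.mem_nhds (by simp [div_self hp]))
  obtain ⟨δ, hδ, hball⟩ := Metric.eventually_nhds_iff_ball.1 hmem
  refine ⟨δ, hδ, fun z => c * (Q z / Q p) ^ ((2 : ℕ) : ℂ)⁻¹, fun z hz => ?_, fun z hz => ?_⟩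
  · refine DifferentiableAt.differentiableWithinAt ?_
    exact (((hQ z).div_const _).cpow (differentiableAt_const _) (hball z hz)).const_mul c
  · have e : (c * (Q z / Q p) ^ ((2 : ℕ) : ℂ)⁻¹) ^ 2 = Q z := by
      rw [mul_pow, Complex.cpow_nat_inv_pow _ two_ne_zero, hc, mul_div_cancel₀ _ hp]
    refine ⟨e, fun h0 => ?_⟩
    have h1 : Q z = 0 := by
      rw [← e]
      exact (pow_eq_zero_iff two_ne_zero).2 h0
    have h2 := Complex.slitPlane_ne_zero (hball z hz)
    rw [h1, zero_div] at h2
    exact h2 rfl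

/-- `D` has, near `p`, a primitive on `U` that vanishes at the boundary point `p`. -/
def HasBoundaryPrimitive (D : ℂ → ℂ) (U : Set ℂ) (p : ℂ) : Prop :=
  ∃ δ > 0, ∃ G : ℂ → ℂ, (∀ z ∈ U ∩ Metric.ball p δ, HasDerivAt G (D z) z) ∧
    ∀ ε > 0, ∃ η > 0, ∀ z ∈ U ∩ Metric.ball p η, ‖G z‖ < ε

section BoundaryPrimitive

variable {U : Set ℂ} {S T Q : ℂ → ℂ} {p : ℂ}

lemma hasDerivAt_quotient {q : ℂ → ℂ} {δ : ℝ} (hU : IsOpen U) (hS : DifferentiableOn ℂ S U)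
    (hq : DifferentiableOn ℂ q (Metric.ball p δ)) (hq0 : ∀ z ∈ Metric.ball p δ, q z ≠ 0) {z : ℂ}
    (hz : z ∈ U ∩ Metric.ball p δ) :
    HasDerivAt (fun z => S z / q z) (deriv (fun z => S z / q z) z) z :=
  ((hS.differentiableAt (hU.mem_nhds hz.1)).fun_div
    (hq.differentiableAt (Metric.isOpen_ball.mem_nhds hz.2)) (hq0 z hz.2)).hasDerivAt

/-- At a point that is not a branch point. -/
lemma hasBoundaryPrimitive_regular (hU : IsOpen U) (hS : DifferentiableOn ℂ S U)
    (hT : Differentiable ℂ T) (hQ : Differentiable ℂ Q) (hSQ : ∀ z ∈ U, S z ^ 2 = Q z)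
    (hp : Q p ≠ 0) : HasBoundaryPrimitive (fun z => T z / S z) U p := by
  obtain ⟨δ, hδ, q, hq, hqQ⟩ := exists_local_sqrt hQ hp
  have hT' : DifferentiableOn ℂ (fun z => T z / q z) (Metric.ball p δ) :=
    hT.differentiableOn.div hq fun z hz => (hqQ z hz).2
  obtain ⟨H, hHp, hH⟩ := hT'.isExactOn_ball.with_val_at p 0
  have hw : ∀ z ∈ U ∩ Metric.ball p δ, (S z / q z) ^ 2 = 1 := fun z hz => by
    rw [div_pow, hSQ z hz.1, (hqQ z hz.2).1, div_self]
    rw [← (hqQ z hz.2).1]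
    exact pow_ne_zero 2 (hqQ z hz.2).2
  -- `S / q` is a locally constant sign, which may differ between the pieces of `U` in the disc. Its
  -- derivative drops out, `(S / q) * (T / q) = T / S`, and the modulus of the primitive does not
  -- depend on the sign.
  refine ⟨δ, hδ, fun z => S z / q z * H z, fun z hz => ?_, fun ε hε => ?_⟩
  · have hd := hasDerivAt_quotient hU hS hq (fun z hz => (hqQ z hz).2) hz
    have hw0 : S z / q z ≠ 0 := fun h0 => by
      have := hw z hz
      rw [h0] at this
      norm_num at this
    have hd0 : deriv (fun z => S z / q z) z = 0 := by
      have h1 : (fun z => (S z / q z) ^ 2) =ᶠ[𝓝 z] fun _ => 1 := by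
        filter_upwards [(hU.inter Metric.isOpen_ball).mem_nhds hz] with v hv using hw v hv
      have h2 := ((hd.fun_pow 2).congr_of_eventuallyEq h1.symm).unique (hasDerivAt_const z 1)
      simpa [hw0, div_eq_zero_iff] using h2
    refine (hd.mul (hH z hz.2)).congr_deriv ?_
    have hS0 : S z ≠ 0 := fun h0 => hw0 (by rw [h0, zero_div])
    have hq0 := (hqQ z hz.2).2
    have e : S z ^ 2 = q z ^ 2 := by rw [hSQ z hz.1, (hqQ z hz.2).1]
    rw [hd0]
    field_simp
    linear_combination T z * e
  · have hc : ContinuousAt H p := (hH p (Metric.mem_ball_self hδ)).continuousAt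
    obtain ⟨η, hη, hηH⟩ := Metric.continuousAt_iff.1 hc ε hε
    refine ⟨min δ η, lt_min hδ hη, fun z hz => ?_⟩
    have hzδ : z ∈ U ∩ Metric.ball p δ :=
      ⟨hz.1, Metric.ball_subset_ball (min_le_left _ _) hz.2⟩
    have h1 : ‖S z / q z‖ = 1 := by
      have := congrArg norm (hw z hzδ)
      rw [norm_pow, norm_one] at this
      exact (pow_eq_one_iff_of_nonneg (norm_nonneg _) two_ne_zero).1 this
    have h2 := hηH (Metric.ball_subset_ball (min_le_right _ _) hz.2)
    rw [hHp, dist_zero_right] at h2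
    rwa [norm_mul, h1, one_mul]

/-- At a branch point. -/
lemma hasBoundaryPrimitive_branchPoint (hU : IsOpen U) (hS : DifferentiableOn ℂ S U)
    (hT : Differentiable ℂ T) (hQ : Differentiable ℂ Q)
    (hSQ : ∀ z ∈ U, S z ^ 2 = (z - p) * Q z) (hS0 : ∀ z ∈ U, S z ≠ 0)
    (hp : Q p ≠ 0) : HasBoundaryPrimitive (fun z => T z / S z) U p := by
  obtain ⟨δ, hδ, q, hq, hqQ⟩ := exists_local_sqrt hQ hp
  have hsq : ∀ ζ ∈ Metric.ball (0 : ℂ) (√δ), p + ζ ^ 2 ∈ Metric.ball p δ := fun ζ hζ => by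
    rw [mem_ball_zero_iff] at hζ
    rw [Metric.mem_ball, dist_eq_norm, add_sub_cancel_left, norm_pow]
    exact (Real.lt_sqrt (norm_nonneg _)).1 hζ
  have hk : DifferentiableOn ℂ (fun ζ => 2 * T (p + ζ ^ 2) / q (p + ζ ^ 2))
      (Metric.ball 0 (√δ)) := by
    refine DifferentiableOn.div (by fun_prop) (hq.comp (by fun_prop) hsq) fun ζ hζ =>
      (hqQ _ (hsq ζ hζ)).2
  obtain ⟨H, hH0, hH⟩ := hk.isExactOn_ball.with_val_at 0 0
  have hw : ∀ z ∈ U ∩ Metric.ball p δ, (S z / q z) ^ 2 = z - p := fun z hz => by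
    rw [div_pow, hSQ z hz.1, (hqQ z hz.2).1, mul_div_cancel_right₀]
    rw [← (hqQ z hz.2).1]
    exact pow_ne_zero 2 (hqQ z hz.2).2
  have hwnorm : ∀ z ∈ U ∩ Metric.ball p δ, ‖S z / q z‖ = √‖z - p‖ := fun z hz => by
    rw [← hw z hz, norm_pow, Real.sqrt_sq (norm_nonneg _)]
  -- `w = S / q` is a local uniformizer with `w ^ 2 = z - p`. As `dz = 2 w dw`, the form `T / S dz`
  -- becomes `2 T / q dw`, holomorphic at `w = 0` with primitive `H`; and `|w| = √|z - p|` makes `H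
  -- w` small near `p`.
  refine ⟨δ, hδ, fun z => H (S z / q z), fun z hz => ?_, fun ε hε => ?_⟩
  · have hd := hasDerivAt_quotient hU hS hq (fun z hz => (hqQ z hz).2) hz
    have hq0 := (hqQ z hz.2).2
    have hSz := hS0 z hz.1
    have hd1 : 2 * (S z / q z) * deriv (fun z => S z / q z) z = 1 := by
      have h1 : (fun z => (S z / q z) ^ 2) =ᶠ[𝓝 z] fun z => z - p := by
        filter_upwards [(hU.inter Metric.isOpen_ball).mem_nhds hz] with v hv using hw v hv
      have h2 := ((hd.fun_pow 2).congr_of_eventuallyEq h1.symm).unique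
        ((hasDerivAt_id z).sub_const p)
      simpa using h2
    have hmem : S z / q z ∈ Metric.ball (0 : ℂ) (√δ) := by
      rw [mem_ball_zero_iff, hwnorm z hz]
      refine Real.sqrt_lt_sqrt (norm_nonneg _) ?_
      rw [← dist_eq_norm]
      exact hz.2
    have h3 := (hH _ hmem).comp z hd
    rw [hw z hz, add_sub_cancel] at h3
    refine h3.congr_deriv ?_
    have h4 : deriv (fun z => S z / q z) z = q z / (2 * S z) := by
      rw [eq_div_iff (mul_ne_zero two_ne_zero hSz)]
      field_simp at hd1
      linear_combination hd1
    rw [h4]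
    field_simp
  · have hc : ContinuousAt H 0 := (hH 0 (Metric.mem_ball_self (Real.sqrt_pos.2 hδ))).continuousAt
    obtain ⟨η, hη, hηH⟩ := Metric.continuousAt_iff.1 hc ε hε
    refine ⟨min δ (η ^ 2), lt_min hδ (by positivity), fun z hz => ?_⟩
    have hzδ : z ∈ U ∩ Metric.ball p δ :=
      ⟨hz.1, Metric.ball_subset_ball (min_le_left _ _) hz.2⟩
    have h2 : ‖z - p‖ < η ^ 2 := by
      rw [← dist_eq_norm]
      exact Metric.ball_subset_ball (min_le_right _ _) hz.2
    have h3 := hηH (x := S z / q z) (by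
      rw [dist_zero_right, hwnorm z hzδ]
      exact (Real.sqrt_lt' hη).2 h2)
    rwa [hH0, dist_zero_right] at h3

/-- The branch points are distinct, so `p` is either no zero or a simple zero of the polynomial
under the root. -/
lemma hasBoundaryPrimitive_of_isSqrtBranch {n : ℕ} {E : Fin (2 * n + 1) → ℂ}
    (hE : Function.Injective E) (hU : IsOpen U) (hS : IsSqrtBranch E U S)
    (hS0 : ∀ z ∈ U, S z ≠ 0) (hT : Differentiable ℂ T) (p : ℂ) :
    HasBoundaryPrimitive (fun z => T z / S z) U p := by
  by_cases hp : ∃ j, E j = p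
  · obtain ⟨j, rfl⟩ := hp
    refine hasBoundaryPrimitive_branchPoint (Q := fun z => ∏ m ∈ Finset.univ.erase j, (z - E m))
      hU hS.1 hT (by fun_prop) (fun z hz => ?_) hS0 ?_
    · rw [hS.2 z hz, Finset.mul_prod_erase Finset.univ (fun m => z - E m) (Finset.mem_univ j)]
    · refine Finset.prod_ne_zero_iff.2 fun m hm => sub_ne_zero.2 fun h => ?_
      exact Finset.ne_of_mem_erase hm (hE h.symm)
  · push Not at hp
    refine hasBoundaryPrimitive_regular (Q := fun z => ∏ m, (z - E m)) hU hS.1 hT (by fun_prop)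
      hS.2 ?_
    exact Finset.prod_ne_zero_iff.2 fun m _ => sub_ne_zero.2 (hp m).symm

end BoundaryPrimitive

/-! ### Continuation up to the cuts -/

namespace IsContinuationAlong

variable {φ D : ℂ → ℂ} {γ : ℝ → ℂ} {Φ : ℝ → ℂ → ℂ} {U : Set ℂ}

lemma eq_pathIntegral_add {I : Set ℝ} (h : IsContinuationAlong φ γ I Φ) (hI : IsPreconnected I)
    (h0 : 0 ∈ I) (hγ : ContinuousOn γ I) (hU : IsOpen U) (hD : DifferentiableOn ℂ D U)
    (hγU : ∀ t ∈ I, γ t ∈ U) (hφ : IsPrimitiveNear D φ (γ 0)) {s t : ℝ} (hst : s ≤ t)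
    (hsub : Icc s t ⊆ I) (hpc : IsPiecewiseC1On γ s t) :
    Φ t (γ t) = pathIntegral D γ s t + Φ s (γ s) := by
  rw [← sub_eq_iff_eq_add]
  refine sub_eq_pathIntegral hst hpc (fun u hu => (hD.differentiableAt
    (hU.mem_nhds (hγU u (hsub hu)))).continuousAt) (A := fun u => Φ u (γ u)) fun u hu => ?_
  refine ⟨Φ u, (h.isPrimitiveNear hI h0 hγ (fun v hv => hD.analyticOnNhd hU _ (hγU v hv)) hφ
    (hsub hu)).hasDerivAt, ?_⟩
  filter_upwards [nhdsWithin_mono u hsub (h.2.1 u (hsub hu))] with v hv using hv.eq_of_nhds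

/-- On the final piece of the path the continuation is `G` plus a constant. As `G` tends to zero at
the end point, the constant is the limit `L`. It persists along every further path in the small disc
because `G` is single-valued there. -/
lemma exists_boundary_value (h : IsContinuationAlong φ γ (Ico 0 1) Φ)
    (hγ : ContinuousOn γ (Icc 0 1)) (hU : IsOpen U) (hD : DifferentiableOn ℂ D U)
    (hγU : ∀ t ∈ Ico (0 : ℝ) 1, γ t ∈ U) (hφ : IsPrimitiveNear D φ (γ 0))
    (hG : HasBoundaryPrimitive D U (γ 1)) :
    ∃ L : ℂ, Tendsto (fun t => Φ t (γ t)) (𝓝[<] 1) (𝓝 L) ∧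
      ∀ ε > 0, ∃ δ > 0, ∀ t ∈ Ico (0 : ℝ) 1, (∀ u ∈ Ico t 1, γ u ∈ Metric.ball (γ 1) δ) →
        ∀ σ : ℝ → ℂ, ContinuousOn σ (Icc 0 1) → σ 0 = γ t →
          (∀ u ∈ Icc (0 : ℝ) 1, σ u ∈ U ∩ Metric.ball (γ 1) δ) →
          ∀ Ψ : ℝ → ℂ → ℂ, IsContinuationAlong (Φ t) σ (Icc 0 1) Ψ → dist (Ψ 1 (σ 1)) L < ε := by
  obtain ⟨δ, hδ, G, hGD, hG0⟩ := hG
  have hDan := hD.analyticOnNhd hU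
  have hγ' : ContinuousOn γ (Ico 0 1) := hγ.mono Ico_subset_Icc_self
  have hΦ : ∀ t ∈ Ico (0 : ℝ) 1, IsPrimitiveNear D (Φ t) (γ t) := fun t ht =>
    h.isPrimitiveNear isPreconnected_Ico (by simp) hγ' (fun v hv => hDan _ (hγU v hv)) hφ ht
  have hGnear : ∀ z ∈ U ∩ Metric.ball (γ 1) δ, IsPrimitiveNear D G z := fun z hz => by
    filter_upwards [(hU.inter Metric.isOpen_ball).mem_nhds hz] with w hw using hGD w hw
  have hconst : ∀ t ∈ Ico (0 : ℝ) 1, (∀ u ∈ Ico t 1, γ u ∈ Metric.ball (γ 1) δ) →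
      ∀ u ∈ Ico t 1, Φ t (γ t) - G (γ t) = Φ u (γ u) - G (γ u) := by
    intro t ht hball u hu
    have hsub : Ico t 1 ⊆ Ico 0 1 := Ico_subset_Ico_left ht.1
    exact h.sub_primitive_eq hsub isPreconnected_Ico (hγ'.mono hsub) (fun v hv => hΦ v (hsub hv))
      (fun v hv => hGnear _ ⟨hγU v (hsub hv), hball v hv⟩) ⟨le_rfl, ht.2⟩ hu
  have hγ1 : Tendsto γ (𝓝[<] 1) (𝓝 (γ 1)) := by
    have h1 : Tendsto γ (𝓝[Icc 0 1] 1) (𝓝 (γ 1)) := hγ 1 (by simp)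
    refine h1.mono_left ?_
    rw [← nhdsWithin_Ico_eq_nhdsLT (zero_lt_one' ℝ)]
    exact nhdsWithin_mono 1 Ico_subset_Icc_self
  have hIco : ∀ᶠ t in 𝓝[<] (1 : ℝ), t ∈ Ico (0 : ℝ) 1 := Ico_mem_nhdsLT zero_lt_one
  obtain ⟨t₀, ht₀, hball₀⟩ : ∃ t₀ ∈ Ico (0 : ℝ) 1, ∀ u ∈ Ico t₀ 1, γ u ∈ Metric.ball (γ 1) δ := by
    have h1 := hγ1.eventually (Metric.ball_mem_nhds (γ 1) hδ)
    obtain ⟨a, ha, hsub⟩ := mem_nhdsLT_iff_exists_Ico_subset.1 h1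
    exact ⟨max a 0, ⟨le_max_right _ _, max_lt ha zero_lt_one⟩, fun u hu =>
      hsub ⟨(le_max_left _ _).trans hu.1, hu.2⟩⟩
  set L := Φ t₀ (γ t₀) - G (γ t₀) with hL
  have hGlim : Tendsto (fun t => G (γ t)) (𝓝[<] 1) (𝓝 0) := by
    rw [Metric.tendsto_nhds]
    intro ε hε
    obtain ⟨η, hη, hηG⟩ := hG0 ε hε
    filter_upwards [hIco, hγ1.eventually (Metric.ball_mem_nhds (γ 1) hη)] with t ht htη
    rw [dist_zero_right]
    exact hηG _ ⟨hγU t ht, htη⟩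
  refine ⟨L, ?_, fun ε hε => ?_⟩
  · have h2 := hGlim.const_add L
    rw [add_zero] at h2
    refine h2.congr' ?_
    filter_upwards [Ico_mem_nhdsLT ht₀.2] with t ht
    rw [hL, hconst t₀ ht₀ hball₀ t ht]
    ring
  · obtain ⟨η, hη, hηG⟩ := hG0 ε hε
    refine ⟨min δ η, lt_min hδ hη, fun t ht hball σ hσ hσ0 hσU Ψ hΨ => ?_⟩
    have hballδ : ∀ u ∈ Ico t 1, γ u ∈ Metric.ball (γ 1) δ := fun u hu =>
      Metric.ball_subset_ball (min_le_left _ _) (hball u hu)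
    -- The constants belonging to `t` and `t₀` are compared at a common later parameter.
    have hmax : max t t₀ < 1 := max_lt ht.2 ht₀.2
    have hΦL : Φ t (γ t) - G (γ t) = L := by
      rw [hconst t ht hballδ _ ⟨le_max_left _ _, hmax⟩,
        ← hconst t₀ ht₀ hball₀ _ ⟨le_max_right _ _, hmax⟩]
    have hσδ : ∀ u ∈ Icc (0 : ℝ) 1, σ u ∈ U ∩ Metric.ball (γ 1) δ := fun u hu =>
      ⟨(hσU u hu).1, Metric.ball_subset_ball (min_le_left _ _) (hσU u hu).2⟩
    have hprim : IsPrimitiveNear D (Φ t) (σ 0) := by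
      rw [hσ0]
      exact hΦ t ht
    have h3 := hΨ.sub_primitive_eq (J := Icc 0 1) (D := D) Subset.rfl isPreconnected_Icc hσ
      (fun u hu => hΨ.isPrimitiveNear isPreconnected_Icc (by simp) hσ
        (fun v hv => hDan _ (hσU v hv).1) hprim hu)
      (fun u hu => hGnear _ (hσδ u hu)) (s := 1) (t := 0) (by simp) (by simp)
    rw [hΨ.2.2.eq_of_nhds, hσ0, hΦL, sub_eq_iff_eq_add] at h3
    rw [h3, dist_eq_norm, add_sub_cancel_left]
    exact hηG _ ⟨(hσU 1 (by simp)).1,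
      Metric.ball_subset_ball (min_le_right _ _) (hσU 1 (by simp)).2⟩

end IsContinuationAlong

end KdV

end

/-! ### The lemma on the mean values of `g` and its reciprocal -/

theorem lemmal3p4 (n : ℕ) (V : ℝ → ℂ) (f : ℕ → ℝ → ℂ) (E : Fin (2 * n + 1) → ℂ)
    (K : KdV.CutSystem n E) (S : ℂ → ℂ)
    (hV : ContDiff ℝ ∞ V) (hQP : KdV.IsQuasiPeriodic V)
    (hKdV : KdV.SolvesStationaryKdV n V f)
    (hR : ∀ z : ℂ, KdV.curvePoly V f n z = ∏ m, (z - E m))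
    (hE : Function.Injective E)
    (hS : KdV.IsSqrtBranch E K.plane S) :
    -- the constant `C` in the definition of `Π_C` exists
    (∃ C : ℝ, 0 < C ∧ KdV.ZerosBoundedBy f n C) ∧
    -- `⟨g(z,·)⟩` exists for `z ∈ Π` and is analytic there
    (∀ z ∈ K.plane, KdV.HasMeanValue (KdV.g f n S z) (KdV.meanG f n S z)) ∧
    AnalyticOnNhd ℂ (KdV.meanG f n S) K.plane ∧
    ∀ C : ℝ, 0 < C → KdV.ZerosBoundedBy f n C →
      -- `⟨g(z,·)⁻¹⟩` exists for `z ∈ Π_C` and is analytic there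
      (∀ z ∈ K.outerPlane C, (∀ x, KdV.g f n S z x ≠ 0) ∧
        KdV.HasMeanValue (fun x => (KdV.g f n S z x)⁻¹) (KdV.meanInvG f n S z)) ∧
      AnalyticOnNhd ℂ (KdV.meanInvG f n S) (K.outerPlane C) ∧
      -- the identity for the mean values themselves, along paths in `Π_C`
      (∀ γ : ℝ → ℂ, KdV.IsPiecewiseC1On γ 0 1 → (∀ t ∈ Icc (0 : ℝ) 1, γ t ∈ K.outerPlane C) →
        KdV.meanInvG f n S (γ 1) =
          -2 * KdV.pathIntegral (KdV.meanG f n S) γ 0 1 + KdV.meanInvG f n S (γ 0)) ∧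
      -- continuation of `⟨g⁻¹⟩` along every path in `Π`, and the identity between any two points
      -- `z₀ = γ s` and `z = γ t` of the path
      (∀ γ : ℝ → ℂ, ContinuousOn γ (Icc 0 1) → γ 0 ∈ K.outerPlane C →
        (∀ t ∈ Icc (0 : ℝ) 1, γ t ∈ K.plane) →
        (∃ Φ : ℝ → ℂ → ℂ, KdV.IsContinuationAlong (KdV.meanInvG f n S) γ (Icc 0 1) Φ) ∧
        ∀ Φ : ℝ → ℂ → ℂ, KdV.IsContinuationAlong (KdV.meanInvG f n S) γ (Icc 0 1) Φ →
          ∀ s t : ℝ, 0 ≤ s → s ≤ t → t ≤ 1 → KdV.IsPiecewiseC1On γ s t →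
            Φ t (γ t) = -2 * KdV.pathIntegral (KdV.meanG f n S) γ s t + Φ s (γ s)) ∧
      -- boundary values: paths in `Π` that end at a point `γ 1` of the cuts
      (∀ γ : ℝ → ℂ, ContinuousOn γ (Icc 0 1) → γ 0 ∈ K.outerPlane C →
        (∀ t ∈ Ico (0 : ℝ) 1, γ t ∈ K.plane) → γ 1 ∈ K.cuts →
        (∃ Φ : ℝ → ℂ → ℂ, KdV.IsContinuationAlong (KdV.meanInvG f n S) γ (Ico 0 1) Φ) ∧
        ∀ Φ : ℝ → ℂ → ℂ, KdV.IsContinuationAlong (KdV.meanInvG f n S) γ (Ico 0 1) Φ →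
          ∃ L : ℂ,
            Tendsto (fun t => Φ t (γ t)) (𝓝[<] 1) (𝓝 L) ∧
            -- the identity at the boundary point, as an improper integral
            (∀ s ∈ Ico (0 : ℝ) 1, (∀ b ∈ Ioo s 1, KdV.IsPiecewiseC1On γ s b) →
              ∃ J : ℂ, Tendsto (fun t => KdV.pathIntegral (KdV.meanG f n S) γ s t)
                (𝓝[<] 1) (𝓝 J) ∧ L = -2 * J + Φ s (γ s)) ∧
            -- `L` is the continuous boundary value on the side from which `γ` arrives
            (∀ ε > 0, ∃ δ > 0, ∀ t ∈ Ico (0 : ℝ) 1,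
              (∀ u ∈ Ico t 1, γ u ∈ Metric.ball (γ 1) δ) →
              ∀ σ : ℝ → ℂ, ContinuousOn σ (Icc 0 1) → σ 0 = γ t →
                (∀ u ∈ Icc (0 : ℝ) 1, σ u ∈ K.plane ∩ Metric.ball (γ 1) δ) →
                ∀ Ψ : ℝ → ℂ → ℂ, KdV.IsContinuationAlong (Φ t) σ (Icc 0 1) Ψ →
                  dist (Ψ 1 (σ 1)) L < ε)) := by
  have hVap := hQP.isAlmostPeriodic
  obtain ⟨B, hB⟩ := hVap.bounded
  obtain ⟨A, hA0, hA⟩ := hKdV.exists_norm_iteratedDeriv_le hV hB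
  have hap : ∀ l ≤ n, KdV.IsAlmostPeriodic (f l) := fun l hl => hKdV.isAlmostPeriodic hV hVap hl
  have hsm := hKdV.1.contDiff
  have hf0 := hKdV.1.apply_zero
  have hopen : IsOpen K.plane := K.isOpen_plane
  have hS0 : ∀ z ∈ K.plane, S z ≠ 0 := fun z hz h0 => by
    have h1 := hS.2 z hz
    rw [h0, zero_pow two_ne_zero] at h1
    obtain ⟨m, -, hm⟩ := Finset.prod_eq_zero_iff.1 h1.symm
    rw [sub_eq_zero.1 hm] at hz
    exact hz (K.branchPoint_mem_cuts m)
  have hSR : ∀ z ∈ K.plane, ∀ x, S z ^ 2 = KdV.firstIntegral V f n z x := fun z hz x => by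
    rw [hKdV.firstIntegral_eq_curvePoly hV, hR, hS.2 z hz]
  have hG : DifferentiableOn ℂ (KdV.meanG f n S) K.plane :=
    KdV.differentiableOn_meanG hap hS.1 hS0
  set D : ℂ → ℂ := fun z => -2 * KdV.meanG f n S z with hD
  have hDdiff : DifferentiableOn ℂ D K.plane := hG.const_mul (-2)
  have hbdry : ∀ p, KdV.HasBoundaryPrimitive D K.plane p := fun p => by
    -- The numerator is a polynomial in `z`, so the only singularities of `D` at the cuts come from
    -- the root.
    have hDT : D = fun z => -Complex.I * KdV.meanF f n z / S z := by
      ext z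
      rw [hD]
      simp only [KdV.meanG_eq hap]
      rw [mul_comm (2 : ℂ), ← div_div]
      ring
    rw [hDT]
    exact KdV.hasBoundaryPrimitive_of_isSqrtBranch hE hopen hS hS0
      ((KdV.differentiable_meanF f n).const_mul _) p
  refine ⟨KdV.exists_zerosBoundedBy hf0 hA0 fun l hl x => ?_, fun z _ =>
    (KdV.isAlmostPeriodic_g hap S z).hasMeanValue, hG.analyticOnNhd hopen, fun C _ hC => ?_⟩
  · simpa using hA l hl 0 (by omega) x
  have hout : IsOpen (K.outerPlane C) := K.isOpen_outerPlane C
  have hsub : K.outerPlane C ⊆ K.plane := sdiff_subset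
  have hF : ∀ z ∈ K.outerPlane C, ∀ x, 1 ≤ ‖KdV.F f n z x‖ := fun z hz x => by
    refine KdV.one_le_norm_F hf0 hC ?_ x
    by_contra! hlt
    exact hz.2 (Or.inl hlt.le)
  have hder : ∀ z ∈ K.outerPlane C, HasDerivAt (KdV.meanInvG f n S) (D z) z := fun z hz =>
    KdV.hasDerivAt_meanInvG hsm hap hA hout (hS.1.mono hsub) (fun z hz => hSR z (hsub hz))
      (fun z hz => hS0 z (hsub hz)) hF hz
  have hinv : AnalyticOnNhd ℂ (KdV.meanInvG f n S) (K.outerPlane C) :=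
    DifferentiableOn.analyticOnNhd (fun z hz =>
      (hder z hz).differentiableAt.differentiableWithinAt) hout
  have hprim : ∀ z ∈ K.outerPlane C, KdV.IsPrimitiveNear D (KdV.meanInvG f n S) z := fun z hz => by
    filter_upwards [hout.mem_nhds hz] with w hw using hder w hw
  refine ⟨fun z hz => ⟨fun x hx => ?_, ?_⟩, hinv, fun γ hγ hγP => ?_, fun γ hγ h0 hγP => ?_,
    fun γ hγ h0 hγP _ => ?_⟩
  · rw [KdV.g, div_eq_zero_iff] at hx
    rcases hx with hx | hx
    · have h1 := hF z hz x
      rw [(mul_eq_zero.1 hx).resolve_left Complex.I_ne_zero, norm_zero] at h1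
      linarith
    · exact hS0 z (hsub hz) ((mul_eq_zero.1 hx).resolve_left two_ne_zero)
  · exact (KdV.isAlmostPeriodic_inv_g hap (hS0 z (hsub hz)) (hF z hz)).hasMeanValue
  · rw [← KdV.pathIntegral_const_mul, ← sub_eq_iff_eq_add]
    exact KdV.sub_eq_pathIntegral zero_le_one hγ (fun t ht => (hDdiff.differentiableAt
      (hopen.mem_nhds (hsub (hγP t ht)))).continuousAt) (A := fun t => KdV.meanInvG f n S (γ t))
      fun t ht => ⟨_, hder _ (hγP t ht), Eventually.of_forall fun _ => rfl⟩
  · refine ⟨KdV.exists_continuation_Icc zero_le_one hopen hDdiff hγ hγP (hinv _ h0) (hprim _ h0),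
      fun Φ hΦ s t hs hst ht hpc => ?_⟩
    rw [← KdV.pathIntegral_const_mul]
    exact hΦ.eq_pathIntegral_add isPreconnected_Icc (by simp) hγ hopen hDdiff hγP (hprim _ h0) hst
      (Icc_subset_Icc hs ht) hpc
  · have hγ' : ContinuousOn γ (Ico 0 1) := hγ.mono Ico_subset_Icc_self
    refine ⟨KdV.exists_continuation_Ico hopen hDdiff hγ' hγP (hinv _ h0) (hprim _ h0),
      fun Φ hΦ => ?_⟩
    obtain ⟨L, hL, hLside⟩ := hΦ.exists_boundary_value hγ hopen hDdiff hγP (hprim _ h0) (hbdry _)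
    -- The value of the improper integral is read off from the identity. Convergence follows from
    -- the existence of `L`, since for `t < 1` the integral is an affine function of the continued
    -- value at `t`.
    refine ⟨L, hL, fun s hs hpc => ⟨-(1 / 2) * (L - Φ s (γ s)), ?_, by ring⟩, hLside⟩
    refine ((hL.sub_const (Φ s (γ s))).const_mul (-(1 / 2))).congr' ?_
    filter_upwards [Ioo_mem_nhdsLT hs.2] with t ht
    rw [hΦ.eq_pathIntegral_add isPreconnected_Ico (by simp) hγ' hopen hDdiff hγP (hprim _ h0)
      ht.1.le (fun u hu => ⟨hs.1.trans hu.1, hu.2.trans_lt ht.2⟩) (hpc t ht), hD,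
      KdV.pathIntegral_const_mul]
    ring
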